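/- Let $\Lambda_n$ be the $n\times n$ square lattice with $4n$ additional dangling edges attached along its boundary, so that each of the $n^2$ vertices has degree 4. Let $\Omega_n$ be the set of all orientations of the edges of $\Lambda_n$ in which every vertex has two incoming and two outgoing edges (free boundary conditions: the dangling edges are not constrained). For $a,b,c>0$ give $x\in\Omega_n$ the probability $\pi_n(x)=\frac1{Z_n}\prod_v w_v(x)$, where $Z_n=\sum_{x\in\Omega_n}\prod_v w_v(x)$ and $w_v(x)=a$ if the four arrows at $v$ point only north and east or only south and west, $w_v(x)=b$ if they point only north and west or only south and east, and $w_v(x)=c$ in the remaining two cases (the two horizontal arrows at $v$ both point in and the two vertical ones both point out, or vice versa). One step of Glauber dynamics chooses one of the $(n+1)^2$ cells of $\Lambda_n$ uniformly at random, including the boundary cells that are only partially enclosed. If the edges bounding the cell are all oriented clockwise or all oriented counterclockwise around it, they are all reversed with the Metropolis–Hastings probability $\min(1,\pi_n(x')/\pi_n(x))$, where $x$ is the current state and $x'$ the state after the reversal; in all other cases the chain stays put. Let $P_n$ be the transition matrix and let $$\tau_n=\min\Big\{t\in\mathbb Z_{\ge 0}:\ \max_{x\in\Omega_n}\tfrac12\sum_{y\in\Omega_n}|P_n^t(x,y)-\pi_n(y)|\le\tfrac14\Big\}$$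 be the mixing time. **Theorem.** For all real numbers $a,b,c>0$ with $ac+bc+3ab<c^2$, Glauber dynamics for the six-vertex model on $\Lambda_n$ with free boundary conditions mixes exponentially slowly: there is a constant $\kappa=\kappa(a,b,c)>0$ such that $\tau_n\ge e^{\kappa n}$ for all sufficiently large $n$. -/

import Mathlib

noncomputable section

namespace SixVertex

/-! ## The lattice

Vertices are pairs (column, row). Every row carries `n + 1` horizontal edges (the first and the last
are dangling) and every column carries `n + 1` vertical edges, so there are `4 * n` dangling edges
and each of the `n ^ 2` vertices has degree four. -/

/-- The vertices of the `n × n` lattice, as pairs (column, row). -/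
abbrev Vertex (n : ℕ) := Fin n × Fin n

/-- The edges: `Sum.inl (r, p)` is the horizontal edge number `p` in row `r`, counted from the
left; `Sum.inr (k, p)` is the vertical edge number `p` in column `k`, counted from the bottom. -/
abbrev Edge (n : ℕ) := (Fin n × Fin (n + 1)) ⊕ (Fin n × Fin (n + 1))

/-- The cells, including those on the boundary that are only partially enclosed. Cell `(i, j)`
lies between columns `i - 1` and `i` and between rows `j - 1` and `j`. -/
abbrev Cell (n : ℕ) := Fin (n + 1) × Fin (n + 1)

variable {n : ℕ}

/-- The edge leaving the vertex to the west. -/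
def leftEdge (v : Vertex n) : Edge n := Sum.inl (v.2, v.1.castSucc)

/-- The edge leaving the vertex to the east. -/
def rightEdge (v : Vertex n) : Edge n := Sum.inl (v.2, v.1.succ)

/-- The edge leaving the vertex to the south. -/
def bottomEdge (v : Vertex n) : Edge n := Sum.inr (v.1, v.2.castSucc)

/-- The edge leaving the vertex to the north. -/
def topEdge (v : Vertex n) : Edge n := Sum.inr (v.1, v.2.succ)

/-! ## Configurations -/

/-- An orientation of all edges: `true` means east for a horizontal edge and north for a vertical
edge, `false` means west, respectively south. -/
abbrev Orientation (n : ℕ) := Edge n → Bool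

/-- The number of edges at `v` that are directed into `v`. -/
def inDegree (x : Orientation n) (v : Vertex n) : ℕ :=
  (if x (leftEdge v) = true then 1 else 0) + (if x (rightEdge v) = false then 1 else 0) +
    (if x (bottomEdge v) = true then 1 else 0) + (if x (topEdge v) = false then 1 else 0)

/-- Two edges in and (as all degrees are four) two edges out at every vertex. -/
def IceRule (x : Orientation n) : Prop := ∀ v : Vertex n, inDegree x v = 2

instance (x : Orientation n) : Decidable (IceRule x) :=
  inferInstanceAs (Decidable (∀ v : Vertex n, inDegree x v = 2))

/-- The state space with free boundary conditions: all orientations that obey the ice rule, with no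
constraint on the dangling edges. -/
abbrev State (n : ℕ) := {x : Orientation n // IceRule x}

/-- The Boltzmann weight of a vertex obeying the ice rule: `a` if all four arrows point east/north
or all point west/south, `b` for the other two types in which both lines go straight through,
`c` for the two types in which the horizontal arrows are opposite to each other (and so are the
vertical ones). -/
def vertexWeight (a b c : ℝ) (x : Orientation n) (v : Vertex n) : ℝ :=
  if x (leftEdge v) = x (rightEdge v) then
    if x (leftEdge v) = x (bottomEdge v) then a else b
  else c

/-- The weight of a configuration. -/
def weight (a b c : ℝ) (x : State n) : ℝ := ∏ v : Vertex n, vertexWeight a b c x.1 v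

/-- The partition function. -/
def partitionFunction (n : ℕ) (a b c : ℝ) : ℝ := ∑ x : State n, weight a b c x

/-- The Gibbs distribution. -/
def gibbs (a b c : ℝ) (x : State n) : ℝ := weight a b c x / partitionFunction n a b c

/-! ## Reversing a cell -/

/-- The direction of the edge `e` in the counterclockwise orientation of the boundary of the
cell `f`, if `e` bounds `f`. -/
def ccw (f : Cell n) : Edge n → Option Bool
  | Sum.inl (r, p) =>
      if p = f.1 then
        if (r : ℕ) + 1 = f.2 then some true else if (r : ℕ) = f.2 then some false else none
      else none
  | Sum.inr (k, p) =>
      if p = f.2 then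
        if (k : ℕ) = f.1 then some true else if (k : ℕ) + 1 = f.1 then some false else none
      else none

/-- The edges that bound `f` are all oriented counterclockwise, or all oriented clockwise,
around `f`. -/
def IsCyclic (x : Orientation n) (f : Cell n) : Prop :=
  (∀ e d, ccw f e = some d → x e = d) ∨ (∀ e d, ccw f e = some d → x e = !d)

/-- Reverse all edges that bound `f`. -/
def reverse (x : Orientation n) (f : Cell n) : Orientation n :=
  fun e => if (ccw f e).isSome then !(x e) else x e

theorem iceRule_reverse {x : Orientation n} (hx : IceRule x) {f : Cell n} (hf : IsCyclic x f) :
    IceRule (reverse x f) := by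
  rintro ⟨i, j⟩
  have h := hx (i, j)
  obtain ⟨p, q⟩ := f
  have H : ∀ e₁ e₂ d₁ d₂, ccw (p, q) e₁ = some d₁ → ccw (p, q) e₂ = some d₂ →
      (x e₁ = d₁ ∧ x e₂ = d₂) ∨ (x e₁ = !d₁ ∧ x e₂ = !d₂) := fun e₁ e₂ d₁ d₂ h₁ h₂ =>
    hf.imp (fun H => ⟨H _ _ h₁, H _ _ h₂⟩) (fun H => ⟨H _ _ h₁, H _ _ h₂⟩)
  have hlb := H (leftEdge (i, j)) (bottomEdge (i, j))
  have hlt := H (leftEdge (i, j)) (topEdge (i, j))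
  have hrb := H (rightEdge (i, j)) (bottomEdge (i, j))
  have hrt := H (rightEdge (i, j)) (topEdge (i, j))
  have kl : ccw (p, q) (leftEdge (i, j)) = if (i : ℕ) = p then
      if (j : ℕ) + 1 = q then some true else if (j : ℕ) = q then some false else none
      else none := by simp [ccw, leftEdge, Fin.ext_iff]
  have kr : ccw (p, q) (rightEdge (i, j)) = if (i : ℕ) + 1 = p then
      if (j : ℕ) + 1 = q then some true else if (j : ℕ) = q then some false else none
      else none := by simp [ccw, rightEdge, Fin.ext_iff]
  have kb : ccw (p, q) (bottomEdge (i, j)) = if (j : ℕ) = q then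
      if (i : ℕ) = p then some true else if (i : ℕ) + 1 = p then some false else none
      else none := by simp [ccw, bottomEdge, Fin.ext_iff]
  have kt : ccw (p, q) (topEdge (i, j)) = if (j : ℕ) + 1 = q then
      if (i : ℕ) = p then some true else if (i : ℕ) + 1 = p then some false else none
      else none := by simp [ccw, topEdge, Fin.ext_iff]
  clear H hf hx
  unfold inDegree reverse at *
  generalize ccw (p, q) (leftEdge (i, j)) = cl at *
  generalize ccw (p, q) (rightEdge (i, j)) = cr at *
  generalize ccw (p, q) (bottomEdge (i, j)) = cb at *
  generalize ccw (p, q) (topEdge (i, j)) = ct at *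
  generalize x (leftEdge (i, j)) = l at *
  generalize x (rightEdge (i, j)) = r at *
  generalize x (bottomEdge (i, j)) = b at *
  generalize x (topEdge (i, j)) = t at *
  cases l <;> cases r <;> cases b <;> cases t <;> simp at h <;> grind

/-- The state obtained from `x` by reversing the cyclically oriented cell `f`. -/
def flip (x : State n) (f : Cell n) (hf : IsCyclic x.1 f) : State n :=
  ⟨reverse x.1 f, iceRule_reverse x.2 hf⟩

/-! ## Glauber dynamics -/

open Classical in
/-- The transition kernel once the cell `f` has been chosen: if `f` is oriented cyclically, its
reversal is accepted with the Metropolis-Hastings probability; otherwise nothing happens. -/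
def cellKernel (a b c : ℝ) (f : Cell n) (x y : State n) : ℝ :=
  if hf : IsCyclic x.1 f then
    let p := min 1 (gibbs a b c (flip x f hf) / gibbs a b c x)
    p * (if y = flip x f hf then 1 else 0) + (1 - p) * (if y = x then 1 else 0)
  else if y = x then 1 else 0

/-- The transition matrix of the Glauber dynamics with free boundary conditions: a cell is chosen
uniformly at random. -/
def glauber (n : ℕ) (a b c : ℝ) : Matrix (State n) (State n) ℝ :=
  Matrix.of fun x y => (∑ f : Cell n, cellKernel a b c f x y) / Fintype.card (Cell n)

/-! ## Mixing times -/

/-- The total variation distance. -/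
def tvDist {Ω : Type*} [Fintype Ω] (μ ν : Ω → ℝ) : ℝ := 1 / 2 * ∑ x, |μ x - ν x|

/-- The mixing time: the least `t` such that the law after `t` steps is within `1 / 4` of `π` from
every starting state (`⊤` if there is none). -/
def mixingTime {Ω : Type*} [Fintype Ω] [DecidableEq Ω] (P : Matrix Ω Ω ℝ) (π : Ω → ℝ) : ℕ∞ :=
  ⨅ (t : ℕ) (_ : ∀ x, tvDist ((P ^ t) x) π ≤ 1 / 4), (t : ℕ∞)

end SixVertex

end

noncomputable section

namespace SixVertex

variable {n : ℕ}

/-! ## Bottlenecks of finite Markov chains -/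

section Markov

variable {Ω : Type*} [Fintype Ω] [DecidableEq Ω]

/-! Since `c` dominates, a typical state is close to one of two ground states, in which every vertex
has weight `c` and which are exchanged by reversing all edges. A vertex of weight `a` or `b` is a
defect: its four edges split into two adjacent pairs that follow different ground states, so it
links two diagonally opposite cells. The ice rule gives every interior cell an even number of links
(`isEven_vertexType`), so the links form contours that are closed or end on the boundary.

Peierls argument: reversing all edges on one side of a contour turns its vertices into `c`-vertices
and alters no other vertex type (`exists_erase`). For a fixed contour this map is injective, so the
contour has probability at most the product of the factors α = a/c and β = b/c along it
(`sum_weight_carries_le`). Contours are nonbacktracking diagonal walks, and their weighted number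
decays exponentially in the length if α + β + 3αβ < 1 (`exists_sum_nonbacktracking_le`), which is
the hypothesis divided by c². Hence contours of length at least n/3 are exponentially unlikely
(`sum_weight_longContour_le`).

Without long contours a state has a well-defined ground state in the background, encoded by an
element of `ZMod 2` that no single flip between such states can change (`background_reverse`).
Global reversal preserves weights and exchanges the two backgrounds, so each has stationary mass
close to one half, and the chain passes from one to the other only through states with a long
contour. The conductance bound `bottleneck` then makes the mixing time exponentially large. -/

theorem pow_nonneg_entries {P : Matrix Ω Ω ℝ} (h0 : ∀ x y, 0 ≤ P x y) (t : ℕ) :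
    ∀ x y, 0 ≤ (P ^ t) x y := by
  induction t with
  | zero => intro x y; rw [pow_zero, Matrix.one_apply]; split_ifs <;> norm_num
  | succ t ih =>
    intro x y
    rw [pow_succ', Matrix.mul_apply]
    exact Finset.sum_nonneg fun z _ => mul_nonneg (h0 _ _) (ih _ _)

theorem pow_row_sum {P : Matrix Ω Ω ℝ} (h1 : ∀ x, ∑ y, P x y = 1) (t : ℕ) :
    ∀ x, ∑ y, (P ^ t) x y = 1 := by
  induction t with
  | zero => intro x; simp [Matrix.one_apply]
  | succ t ih =>
    intro x
    simp_rw [pow_succ', Matrix.mul_apply]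
    rw [Finset.sum_comm]
    simp_rw [← Finset.mul_sum, ih, mul_one, h1]

/-- Started from the stationary law restricted to `S`, the chain leaves `S` within `t` steps only
by way of `F`, so with probability at most `t * π F`. -/
theorem escape_le {P : Matrix Ω Ω ℝ} {π : Ω → ℝ} (h0 : ∀ x y, 0 ≤ P x y)
    (h1 : ∀ x, ∑ y, P x y = 1) (hπ : ∀ x, 0 ≤ π x) (hst : ∀ y, ∑ x, π x * P x y = π y)
    {S F : Finset Ω} (hF : ∀ x ∈ S, ∀ y ∉ S, y ∉ F → P x y = 0) (t : ℕ) :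
    ∑ x ∈ S, π x * ∑ y ∈ Sᶜ, (P ^ t) x y ≤ t * ∑ y ∈ F, π y := by
  have hp := pow_nonneg_entries h0
  have hE : ∀ t z, ∑ y ∈ Sᶜ, (P ^ t) z y ≤ 1 := fun t z => by
    rw [← pow_row_sum h1 t z]
    exact Finset.sum_le_sum_of_subset_of_nonneg (Finset.subset_univ _) fun y _ _ => hp t z y
  induction t with
  | zero =>
    have : ∀ x ∈ S, π x * ∑ y ∈ Sᶜ, (P ^ 0) x y = 0 := fun x hx => by
      rw [Finset.sum_eq_zero, mul_zero]
      intro y hy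
      rw [pow_zero, Matrix.one_apply_ne]
      rintro rfl
      exact (Finset.mem_compl.1 hy) hx
    rw [Finset.sum_eq_zero this]; simp
  | succ t ih =>
    -- Decomposition by the first step, which stays in `S` or else lands in `F`. In the latter case
    -- the later escape probability is bounded by 1.
    have key : ∀ x ∈ S, π x * ∑ y ∈ Sᶜ, (P ^ (t + 1)) x y ≤
        ∑ z ∈ S, π x * P x z * (∑ y ∈ Sᶜ, (P ^ t) z y) + π x * ∑ z ∈ F, P x z := fun x hx => by
      simp_rw [pow_succ', Matrix.mul_apply]
      rw [Finset.sum_comm]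
      simp_rw [← Finset.mul_sum]
      rw [← Finset.sum_add_sum_compl S, mul_add, Finset.mul_sum, Finset.mul_sum]
      refine add_le_add (le_of_eq (Finset.sum_congr rfl fun z _ => by ring)) ?_
      have hnn : ∀ z, 0 ≤ π x * (P x z * ∑ y ∈ Sᶜ, (P ^ t) z y) := fun z =>
        mul_nonneg (hπ _) (mul_nonneg (h0 _ _) (Finset.sum_nonneg fun y _ => hp t z y))
      calc ∑ z ∈ Sᶜ, π x * (P x z * ∑ y ∈ Sᶜ, (P ^ t) z y)
          = ∑ z ∈ Sᶜ ∩ F, π x * (P x z * ∑ y ∈ Sᶜ, (P ^ t) z y) := by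
            symm
            refine Finset.sum_subset Finset.inter_subset_left fun z hz hz' => ?_
            rw [hF x hx z (Finset.mem_compl.1 hz) fun h => hz' (Finset.mem_inter.2 ⟨hz, h⟩)]
            ring
        _ ≤ ∑ z ∈ F, π x * (P x z * ∑ y ∈ Sᶜ, (P ^ t) z y) :=
            Finset.sum_le_sum_of_subset_of_nonneg Finset.inter_subset_right fun z _ _ => hnn z
        _ ≤ ∑ z ∈ F, π x * P x z := Finset.sum_le_sum fun z _ => by
            have := mul_le_mul_of_nonneg_left (hE t z) (mul_nonneg (hπ x) (h0 x z))
            linarith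
        _ = π x * ∑ z ∈ F, P x z := (Finset.mul_sum _ _ _).symm
    refine (Finset.sum_le_sum key).trans ?_
    rw [Finset.sum_add_distrib]
    have hA : ∀ z, ∑ x ∈ S, π x * P x z ≤ π z := fun z => by
      rw [← hst z]
      exact Finset.sum_le_sum_of_subset_of_nonneg (Finset.subset_univ _)
        fun x _ _ => mul_nonneg (hπ x) (h0 x z)
    have e1 : ∑ x ∈ S, ∑ z ∈ S, π x * P x z * (∑ y ∈ Sᶜ, (P ^ t) z y) ≤ t * ∑ y ∈ F, π y := by
      refine le_trans ?_ ih
      rw [Finset.sum_comm]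
      simp_rw [← Finset.sum_mul]
      exact Finset.sum_le_sum fun z _ =>
        mul_le_mul_of_nonneg_right (hA z) (Finset.sum_nonneg fun y _ => hp t z y)
    have e2 : ∑ x ∈ S, π x * ∑ z ∈ F, P x z ≤ ∑ y ∈ F, π y := by
      simp_rw [Finset.mul_sum]
      rw [Finset.sum_comm]
      exact Finset.sum_le_sum fun z _ => hA z
    push_cast
    linarith

theorem sum_sub_le_tvDist {μ ν : Ω → ℝ} (h : ∑ x, μ x = ∑ x, ν x) (A : Finset Ω) :
    ∑ x ∈ A, ν x - ∑ x ∈ A, μ x ≤ tvDist μ ν := by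
  have h2 := Finset.sum_add_sum_compl A μ
  have h3 := Finset.sum_add_sum_compl A ν
  have h4 := Finset.sum_add_sum_compl A fun x => |μ x - ν x|
  have h5 : ∑ x ∈ A, (ν x - μ x) ≤ ∑ x ∈ A, |μ x - ν x| := Finset.sum_le_sum fun x _ => by
    rw [abs_sub_comm]; exact le_abs_self _
  have h6 : ∑ x ∈ Aᶜ, (μ x - ν x) ≤ ∑ x ∈ Aᶜ, |μ x - ν x| :=
    Finset.sum_le_sum fun x _ => le_abs_self _
  rw [Finset.sum_sub_distrib] at h5 h6
  unfold tvDist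
  linarith

/-- A set of stationary mass at most one half that can only be left through `F` forces the mixing
time to be at least `π S / (4 * π F)`. -/
theorem bottleneck {P : Matrix Ω Ω ℝ} {π : Ω → ℝ} (h0 : ∀ x y, 0 ≤ P x y)
    (h1 : ∀ x, ∑ y, P x y = 1) (hπ : ∀ x, 0 ≤ π x) (hπ1 : ∑ x, π x = 1)
    (hst : ∀ y, ∑ x, π x * P x y = π y)
    {S F : Finset Ω} (hF : ∀ x ∈ S, ∀ y ∉ S, y ∉ F → P x y = 0) (hS : ∑ x ∈ S, π x ≤ 1 / 2)
    {t : ℕ} (ht : ∀ x, tvDist ((P ^ t) x) π ≤ 1 / 4) :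
    (∑ x ∈ S, π x) / 4 ≤ t * ∑ y ∈ F, π y := by
  refine le_trans ?_ (escape_le h0 h1 hπ hst hF t)
  rw [Finset.sum_div]
  refine Finset.sum_le_sum fun x _ => ?_
  have h2 := sum_sub_le_tvDist ((pow_row_sum h1 t x).trans hπ1.symm) Sᶜ
  have h3 := Finset.sum_add_sum_compl S π
  have h4 := ht x
  -- At time `t` the chain gives `Sᶜ` mass at least π(Sᶜ) - 1/4, and π(Sᶜ) is at least 1/2.
  have h5 : 1 / 4 ≤ ∑ y ∈ Sᶜ, (P ^ t) x y := by linarith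
  have := mul_le_mul_of_nonneg_left h5 (hπ x)
  linarith

theorem le_mixingTime {P : Matrix Ω Ω ℝ} {π : Ω → ℝ} {K : ℝ}
    (h : ∀ t : ℕ, (∀ x, tvDist ((P ^ t) x) π ≤ 1 / 4) → K ≤ t) :
    ENNReal.ofReal K ≤ (mixingTime P π : ENNReal) := by
  have h1 : ((⌈K⌉₊ : ℕ) : ℕ∞) ≤ mixingTime P π :=
    le_iInf₂ fun t ht => by exact_mod_cast Nat.ceil_le.2 (h t ht)
  calc ENNReal.ofReal K ≤ ENNReal.ofReal (⌈K⌉₊ : ℝ) := ENNReal.ofReal_le_ofReal (Nat.le_ceil K)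
    _ = (((⌈K⌉₊ : ℕ) : ℕ∞) : ENNReal) := by rw [ENNReal.ofReal_natCast]; rfl
    _ ≤ _ := by exact_mod_cast h1

end Markov

/-! ## The Glauber dynamics is reversible -/

section Glauber

variable {a b c : ℝ}

theorem vertexWeight_pos (ha : 0 < a) (hb : 0 < b) (hc : 0 < c) (x : Orientation n)
    (v : Vertex n) : 0 < vertexWeight a b c x v := by
  unfold vertexWeight; split_ifs <;> assumption

theorem weight_pos (ha : 0 < a) (hb : 0 < b) (hc : 0 < c) (x : State n) : 0 < weight a b c x :=
  Finset.prod_pos fun v _ => vertexWeight_pos ha hb hc x.1 v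

theorem partitionFunction_pos (ha : 0 < a) (hb : 0 < b) (hc : 0 < c) :
    0 < partitionFunction n a b c := by
  have : Nonempty (State n) := ⟨⟨fun _ => true, fun v => by simp [inDegree]⟩⟩
  exact Finset.sum_pos (fun x _ => weight_pos ha hb hc x) Finset.univ_nonempty

theorem gibbs_pos (ha : 0 < a) (hb : 0 < b) (hc : 0 < c) (x : State n) : 0 < gibbs a b c x :=
  div_pos (weight_pos ha hb hc x) (partitionFunction_pos ha hb hc)

theorem sum_gibbs (ha : 0 < a) (hb : 0 < b) (hc : 0 < c) : ∑ x : State n, gibbs a b c x = 1 := by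
  unfold gibbs
  rw [← Finset.sum_div]
  exact div_self (partitionFunction_pos ha hb hc).ne'

theorem isCyclic_reverse {x : Orientation n} {f : Cell n} (h : IsCyclic x f) :
    IsCyclic (reverse x f) f := by
  rcases h with h | h
  · right
    intro e d he
    simp [reverse, he, h e d he]
  · left
    intro e d he
    simp [reverse, he, h e d he]

theorem reverse_reverse (x : Orientation n) (f : Cell n) : reverse (reverse x f) f = x := by
  funext e
  unfold reverse
  split_ifs <;> simp

theorem flip_flip (x : State n) (f : Cell n) (h : IsCyclic x.1 f) :
    flip (flip x f h) f (isCyclic_reverse h) = x :=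
  Subtype.ext (reverse_reverse x.1 f)

theorem cellKernel_nonneg (ha : 0 < a) (hb : 0 < b) (hc : 0 < c) (f : Cell n) (x y : State n) :
    0 ≤ cellKernel a b c f x y := by
  by_cases hf : IsCyclic x.1 f
  · have h1 : 0 ≤ min 1 (gibbs a b c (flip x f hf) / gibbs a b c x) :=
      le_min zero_le_one (div_nonneg (gibbs_pos ha hb hc _).le (gibbs_pos ha hb hc _).le)
    have h2 : 0 ≤ 1 - min 1 (gibbs a b c (flip x f hf) / gibbs a b c x) :=
      sub_nonneg.2 (min_le_left _ _)
    rw [cellKernel, dif_pos hf]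
    exact add_nonneg (mul_nonneg h1 (by split_ifs <;> norm_num))
      (mul_nonneg h2 (by split_ifs <;> norm_num))
  · rw [cellKernel, dif_neg hf]
    split_ifs <;> norm_num

theorem cellKernel_eq_zero {f : Cell n} {x y : State n} (hxy : y ≠ x)
    (h : ∀ hf : IsCyclic x.1 f, y ≠ flip x f hf) : cellKernel a b c f x y = 0 := by
  by_cases hf : IsCyclic x.1 f
  · simp [cellKernel, hf, hxy, h hf]
  · simp [cellKernel, hf, hxy]

theorem cellKernel_row_sum (f : Cell n) (x : State n) :
    ∑ y, cellKernel a b c f x y = 1 := by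
  unfold cellKernel
  split_ifs with hf
  · dsimp only
    rw [Finset.sum_add_distrib, ← Finset.mul_sum, ← Finset.mul_sum]
    simp
  · simp

theorem cellKernel_detailed_balance (ha : 0 < a) (hb : 0 < b) (hc : 0 < c) (f : Cell n)
    (x y : State n) :
    gibbs a b c x * cellKernel a b c f x y = gibbs a b c y * cellKernel a b c f y x := by
  rcases eq_or_ne y x with rfl | hxy
  · rfl
  by_cases h : ∃ hf : IsCyclic x.1 f, y = flip x f hf
  · obtain ⟨hf, rfl⟩ := h
    have hf' : IsCyclic (flip x f hf).1 f := isCyclic_reverse hf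
    have hx := gibbs_pos ha hb hc x
    have hy := gibbs_pos ha hb hc (flip x f hf)
    unfold cellKernel
    rw [dif_pos hf, dif_pos hf', flip_flip]
    simp only [if_neg hxy, if_neg hxy.symm, if_true, mul_one, mul_zero, add_zero]
    -- Both sides become the minimum of the two stationary probabilities.
    rw [mul_min_of_nonneg _ _ hx.le, mul_min_of_nonneg _ _ hy.le, mul_div_cancel₀ _ hx.ne',
      mul_div_cancel₀ _ hy.ne', mul_one, mul_one, min_comm]
  · rw [cellKernel_eq_zero hxy fun hf h' => h ⟨hf, h'⟩, cellKernel_eq_zero hxy.symm]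
    · simp
    · rintro hf rfl
      exact h ⟨isCyclic_reverse hf, (flip_flip y f hf).symm⟩

theorem exists_flip_of_glauber_ne_zero {x y : State n} (h : glauber n a b c x y ≠ 0)
    (hxy : y ≠ x) : ∃ f, ∃ hf : IsCyclic x.1 f, y = flip x f hf := by
  by_contra! H
  apply h
  simp only [glauber, Matrix.of_apply]
  rw [Finset.sum_eq_zero fun f _ => cellKernel_eq_zero hxy (H f), zero_div]

theorem glauber_nonneg (ha : 0 < a) (hb : 0 < b) (hc : 0 < c) (x y : State n) :
    0 ≤ glauber n a b c x y :=
  div_nonneg (Finset.sum_nonneg fun f _ => cellKernel_nonneg ha hb hc f x y) (Nat.cast_nonneg _)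

theorem glauber_row_sum (x : State n) : ∑ y, glauber n a b c x y = 1 := by
  simp only [glauber, Matrix.of_apply]
  rw [← Finset.sum_div, Finset.sum_comm]
  simp_rw [cellKernel_row_sum]
  rw [Finset.sum_const, nsmul_eq_mul, mul_one, Finset.card_univ]
  exact div_self (Nat.cast_ne_zero.2 Fintype.card_ne_zero)

theorem glauber_stationary (ha : 0 < a) (hb : 0 < b) (hc : 0 < c) (y : State n) :
    ∑ x, gibbs a b c x * glauber n a b c x y = gibbs a b c y := by
  have : ∀ x, gibbs a b c x * glauber n a b c x y = gibbs a b c y * glauber n a b c y x := by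
    intro x
    simp only [glauber, Matrix.of_apply]
    rw [← mul_div_assoc, ← mul_div_assoc, Finset.mul_sum, Finset.mul_sum]
    congr 1
    exact Finset.sum_congr rfl fun f _ => cellKernel_detailed_balance ha hb hc f x y
  simp_rw [this]
  rw [← Finset.mul_sum, glauber_row_sum, mul_one]

end Glauber

/-! ## Vertex types and their potentials -/

/-- The indicator of `p` modulo two. -/
def ind (p : Prop) [Decidable p] : ZMod 2 := if p then 1 else 0

theorem ind_congr {p q : Prop} [Decidable p] [Decidable q] (h : p ↔ q) : ind p = ind q := by
  unfold ind; simp only [h]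

theorem ind_ne_none (o : Option Bool) :
    ind (o ≠ none) = ind (o = some true) + ind (o = some false) := by
  rcases o with _ | _ | _ <;> decide

/-- The vertices that contribute `a` or `b` to the weight, labelled by `true` and `false`
respectively. An `a`-vertex `(i, j)` separates the north-west pair of its edges from the south-east
pair, so it links the cells `(i, j)` and `(i + 1, j + 1)`; a `b`-vertex links the cells
`(i + 1, j)` and `(i, j + 1)`. -/
def vertexType (x : Orientation n) (i j : ℕ) : Option Bool :=
  if h : i < n ∧ j < n then
    if x (leftEdge (⟨i, h.1⟩, ⟨j, h.2⟩)) = x (rightEdge (⟨i, h.1⟩, ⟨j, h.2⟩)) then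
      some (decide (x (leftEdge (⟨i, h.1⟩, ⟨j, h.2⟩)) = x (bottomEdge (⟨i, h.1⟩, ⟨j, h.2⟩))))
    else none
  else none

theorem vertexType_eq_none {x : Orientation n} {i j : ℕ} (h : ¬ (i < n ∧ j < n)) :
    vertexType x i j = none := dif_neg h

theorem vertexType_apply (x : Orientation n) (v : Vertex n) :
    vertexType x v.1 v.2 = if x (leftEdge v) = x (rightEdge v) then
      some (decide (x (leftEdge v) = x (bottomEdge v))) else none :=
  dif_pos ⟨v.1.2, v.2.2⟩

theorem vertexWeight_eq (a b c : ℝ) (x : Orientation n) (v : Vertex n) :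
    vertexWeight a b c x v = match vertexType x v.1 v.2 with
      | some true => a
      | some false => b
      | none => c := by
  rw [vertexType_apply]
  unfold vertexWeight
  by_cases h1 : x (leftEdge v) = x (rightEdge v)
  · by_cases h2 : x (leftEdge v) = x (bottomEdge v)
    · rw [if_pos h1, if_pos h2, if_pos h1, decide_eq_true h2]
    · rw [if_pos h1, if_neg h2, if_pos h1, decide_eq_false h2]
  · rw [if_neg h1, if_neg h1]

/-- Every cell that is not on the boundary is linked to an even number of its diagonal
neighbours. -/
def IsEven (n : ℕ) (T : ℕ → ℕ → Option Bool) : Prop :=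
  ∀ i j, i + 1 < n → j + 1 < n →
    ind (T i j = some true) + ind (T (i + 1) j = some false) +
      ind (T i (j + 1) = some false) + ind (T (i + 1) (j + 1) = some true) = 0

theorem vertexType_true_iff {x : Orientation n} (v : Vertex n) :
    vertexType x v.1 v.2 = some true ↔
      x (leftEdge v) = x (rightEdge v) ∧ x (leftEdge v) = x (bottomEdge v) := by
  rw [vertexType_apply]; split_ifs with h <;> simp [h]

theorem vertexType_false_iff {x : Orientation n} (v : Vertex n) :
    vertexType x v.1 v.2 = some false ↔
      x (leftEdge v) = x (rightEdge v) ∧ x (leftEdge v) ≠ x (bottomEdge v) := by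
  rw [vertexType_apply]; split_ifs with h <;> simp [h]

theorem iceRule_iff {x : Orientation n} : IceRule x ↔ ∀ v,
    (x (leftEdge v) = x (rightEdge v) ∧ x (bottomEdge v) = x (topEdge v)) ∨
      (x (leftEdge v) = x (topEdge v) ∧ x (bottomEdge v) = x (rightEdge v)) := by
  refine forall_congr' fun v => ?_
  unfold inDegree
  cases x (leftEdge v) <;> cases x (rightEdge v) <;> cases x (bottomEdge v) <;>
    cases x (topEdge v) <;> simp

/-- Two bounding edges of a cell that meet at a corner circulate in opposite senses exactly when the
vertex there links the cell. Once around the cell, the sense changes an even number of times. -/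
theorem isEven_vertexType {x : Orientation n} (hx : IceRule x) : IsEven n (vertexType x) := by
  intro i j hi hj
  have hi' : i < n := by omega
  have hj' : j < n := by omega
  rw [iceRule_iff] at hx
  have h1 := hx (⟨i, hi'⟩, ⟨j, hj'⟩)
  have h2 := hx (⟨i + 1, hi⟩, ⟨j, hj'⟩)
  have h3 := hx (⟨i, hi'⟩, ⟨j + 1, hj⟩)
  have h4 := hx (⟨i + 1, hi⟩, ⟨j + 1, hj⟩)
  rw [ind_congr (vertexType_true_iff (x := x) (⟨i, hi'⟩, ⟨j, hj'⟩)),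
    ind_congr (vertexType_false_iff (x := x) (⟨i + 1, hi⟩, ⟨j, hj'⟩)),
    ind_congr (vertexType_false_iff (x := x) (⟨i, hi'⟩, ⟨j + 1, hj⟩)),
    ind_congr (vertexType_true_iff (x := x) (⟨i + 1, hi⟩, ⟨j + 1, hj⟩))]
  have e1 : rightEdge ((⟨i, hi'⟩, ⟨j, hj'⟩) : Vertex n) = leftEdge (⟨i + 1, hi⟩, ⟨j, hj'⟩) := rfl
  have e2 : rightEdge ((⟨i, hi'⟩, ⟨j + 1, hj⟩) : Vertex n) =
      leftEdge (⟨i + 1, hi⟩, ⟨j + 1, hj⟩) := rfl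
  have e3 : topEdge ((⟨i, hi'⟩, ⟨j, hj'⟩) : Vertex n) = bottomEdge (⟨i, hi'⟩, ⟨j + 1, hj⟩) := rfl
  have e4 : topEdge ((⟨i + 1, hi⟩, ⟨j, hj'⟩) : Vertex n) =
      bottomEdge (⟨i + 1, hi⟩, ⟨j + 1, hj⟩) := rfl
  rw [e1, e3] at h1
  rw [e4] at h2
  rw [e2] at h3
  rw [e1, e2]
  have k1 : (x (leftEdge (⟨i, hi'⟩, ⟨j, hj'⟩)) = x (leftEdge (⟨i + 1, hi⟩, ⟨j, hj'⟩)) ∧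
      x (leftEdge (⟨i, hi'⟩, ⟨j, hj'⟩)) = x (bottomEdge (⟨i, hi'⟩, ⟨j, hj'⟩))) ↔
      x (leftEdge (⟨i + 1, hi⟩, ⟨j, hj'⟩)) = x (bottomEdge (⟨i, hi'⟩, ⟨j + 1, hj⟩)) := by grind
  have k2 : (x (leftEdge (⟨i + 1, hi⟩, ⟨j, hj'⟩)) = x (rightEdge (⟨i + 1, hi⟩, ⟨j, hj'⟩)) ∧
      x (leftEdge (⟨i + 1, hi⟩, ⟨j, hj'⟩)) ≠ x (bottomEdge (⟨i + 1, hi⟩, ⟨j, hj'⟩))) ↔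
      x (leftEdge (⟨i + 1, hi⟩, ⟨j, hj'⟩)) ≠ x (bottomEdge (⟨i + 1, hi⟩, ⟨j + 1, hj⟩)) := by grind
  have k3 : (x (leftEdge (⟨i, hi'⟩, ⟨j + 1, hj⟩)) = x (leftEdge (⟨i + 1, hi⟩, ⟨j + 1, hj⟩)) ∧
      x (leftEdge (⟨i, hi'⟩, ⟨j + 1, hj⟩)) ≠ x (bottomEdge (⟨i, hi'⟩, ⟨j + 1, hj⟩))) ↔
      x (leftEdge (⟨i + 1, hi⟩, ⟨j + 1, hj⟩)) ≠ x (bottomEdge (⟨i, hi'⟩, ⟨j + 1, hj⟩)) := by grind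
  have k4 : (x (leftEdge (⟨i + 1, hi⟩, ⟨j + 1, hj⟩)) = x (rightEdge (⟨i + 1, hi⟩, ⟨j + 1, hj⟩)) ∧
      x (leftEdge (⟨i + 1, hi⟩, ⟨j + 1, hj⟩)) = x (bottomEdge (⟨i + 1, hi⟩, ⟨j + 1, hj⟩))) ↔
      x (leftEdge (⟨i + 1, hi⟩, ⟨j + 1, hj⟩)) = x (bottomEdge (⟨i + 1, hi⟩, ⟨j + 1, hj⟩)) := by
    grind
  rw [ind_congr k1, ind_congr k2, ind_congr k3, ind_congr k4]
  generalize x (leftEdge (⟨i + 1, hi⟩, ⟨j, hj'⟩)) = p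
  generalize x (leftEdge (⟨i + 1, hi⟩, ⟨j + 1, hj⟩)) = q
  generalize x (bottomEdge (⟨i, hi'⟩, ⟨j + 1, hj⟩)) = r
  generalize x (bottomEdge (⟨i + 1, hi⟩, ⟨j + 1, hj⟩)) = s
  revert p q r s
  decide

/-- A discrete Stokes formula: summing the evenness relation over the interior cells between the two
rows leaves only the terms at both ends. -/
theorem IsEven.sum_two_rows {T : ℕ → ℕ → Option Bool} (hT : IsEven n T) {r k : ℕ} (hr : r + 1 < n)
    (hk : k < n) :
    ∑ i ∈ Finset.range k, ind (T i r ≠ none) + ∑ i ∈ Finset.range k, ind (T i (r + 1) ≠ none) =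
      ind (T 0 r = some false) + ind (T 0 (r + 1) = some true) +
        (ind (T k r = some false) + ind (T k (r + 1) = some true)) := by
  induction k with
  | zero => simp [CharTwo.add_self_eq_zero]
  | succ k ih =>
    have h1 := ih (by omega)
    have h2 := hT k r hk hr
    rw [Finset.sum_range_succ, Finset.sum_range_succ, ind_ne_none (T k r),
      ind_ne_none (T k (r + 1))]
    generalize ∑ i ∈ Finset.range k, ind (T i r ≠ none) = A at *
    generalize ∑ i ∈ Finset.range k, ind (T i (r + 1) ≠ none) = B at *
    grind

/-- An even configuration of links separates the edges into two classes. -/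
theorem IsEven.exists_potential {T : ℕ → ℕ → Option Bool} (hT : IsEven n T) :
    ∃ s : Edge n → ZMod 2, ∀ v : Vertex n,
      s (rightEdge v) = s (leftEdge v) + ind (T v.1 v.2 ≠ none) ∧
      s (bottomEdge v) = s (leftEdge v) + ind (T v.1 v.2 = some true) ∧
      s (topEdge v) = s (leftEdge v) + ind (T v.1 v.2 = some false) := by
  -- The potential is integrated up the leftmost column (`σ`) and then eastward along the row (`t`);
  -- `sum_two_rows` provides the independence of the path.
  set σ : ℕ → ZMod 2 := fun r => ∑ j ∈ Finset.range r,
    (ind (T 0 j = some false) + ind (T 0 (j + 1) = some true)) with hσ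
  set t : ℕ → ℕ → ZMod 2 := fun r k => σ r + ∑ i ∈ Finset.range k, ind (T i r ≠ none) with ht
  -- A vertical edge takes its value from the vertex above it; only the dangling edges at the top
  -- have to use the vertex below.
  refine ⟨Sum.elim (fun e => t e.1 e.2) (fun e => if (e.2 : ℕ) < n then
    t e.2 e.1 + ind (T e.1 e.2 = some true) else
      t (e.2 - 1) e.1 + ind (T e.1 (e.2 - 1) = some false)), ?_⟩
  rintro ⟨⟨k, hk⟩, ⟨r, hr⟩⟩
  simp only [rightEdge, leftEdge, bottomEdge, topEdge, Sum.elim_inl, Sum.elim_inr,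
    Fin.val_succ, Fin.val_castSucc, hr, if_true, true_and]
  refine ⟨?_, ?_⟩
  · simp only [ht, Finset.sum_range_succ, add_assoc]
  · split_ifs with h
    · have h1 := hT.sum_two_rows h hk
      simp only [ht, hσ, Finset.sum_range_succ]
      grind
    · simp

/-! ## Erasing a set of links -/

theorem IsEven.exists_bool_potential {T : ℕ → ℕ → Option Bool} (hT : IsEven n T) :
    ∃ s : Edge n → Bool, ∀ v : Vertex n,
      s (rightEdge v) = (s (leftEdge v) ^^ decide (T v.1 v.2 ≠ none)) ∧
      s (bottomEdge v) = (s (leftEdge v) ^^ decide (T v.1 v.2 = some true)) ∧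
      s (topEdge v) = (s (leftEdge v) ^^ decide (T v.1 v.2 = some false)) := by
  obtain ⟨s, hs⟩ := hT.exists_potential
  have key : ∀ p q : ZMod 2, ∀ P : Prop, [Decidable P] → p = q + ind P →
      decide (p = 1) = (decide (q = 1) ^^ decide P) := by
    intro p q P _ h
    by_cases hP : P
    · rw [h, decide_eq_true hP]; simp only [ind, if_pos hP]; clear h; revert q; decide
    · rw [h, decide_eq_false hP]; simp only [ind, if_neg hP]; clear h; revert q; decide
  exact ⟨fun e => decide (s e = 1), fun v =>
    ⟨key _ _ _ (hs v).1, key _ _ _ (hs v).2.1, key _ _ _ (hs v).2.2⟩⟩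

/-- The configuration `x` has all the links of `T`. -/
def Carries (T : ℕ → ℕ → Option Bool) (x : Orientation n) : Prop :=
  ∀ v : Vertex n, T v.1 v.2 ≠ none → vertexType x v.1 v.2 = T v.1 v.2

/-- Reversing one of the two classes of edges separated by `T` erases the links of `T`. -/
theorem exists_erase {T : ℕ → ℕ → Option Bool} (hT : IsEven n T) :
    ∃ s : Edge n → Bool, ∀ x : Orientation n, IceRule x → Carries T x →
      IceRule (fun e => x e ^^ s e) ∧ ∀ v : Vertex n, vertexType (fun e => x e ^^ s e) v.1 v.2 =
        if T v.1 v.2 = none then vertexType x v.1 v.2 else none := by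
  obtain ⟨s, hs⟩ := hT.exists_bool_potential
  -- The set of reversed edges depends on `T` alone and not on `x`; this makes the erasing map
  -- injective.
  refine ⟨s, fun x hx hc => ?_⟩
  rw [iceRule_iff, ← forall_and]
  rw [iceRule_iff] at hx
  intro v
  have h1 := hx v
  have h2 := hc v
  obtain ⟨h3, h4, h5⟩ := hs v
  rw [vertexType_apply] at h2
  rw [vertexType_apply, vertexType_apply, h3, h4, h5]
  generalize T v.1 v.2 = o at *
  generalize x (leftEdge v) = l at *
  generalize x (rightEdge v) = r at *
  generalize x (bottomEdge v) = p at *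
  generalize x (topEdge v) = t at *
  generalize s (leftEdge v) = q at *
  clear hs hc hx h3 h4 h5
  revert o l r p t q
  decide

/-- The relative cost of a link. -/
def linkCost (α β : ℝ) : Option Bool → ℝ
  | some true => α
  | some false => β
  | none => 1

/-- The Peierls estimate: erasing `T` multiplies the weight by the inverse of the product of link
costs, and the images of distinct states are distinct, so their weights sum to at most the partition
function. -/
theorem sum_weight_carries_le {a b c : ℝ} (ha : 0 < a) (hb : 0 < b) (hc : 0 < c)
    {T : ℕ → ℕ → Option Bool} (hT : IsEven n T) (A : Finset (State n))
    (hA : ∀ x ∈ A, Carries T x.1) :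
    ∑ x ∈ A, weight a b c x ≤
      (∏ v : Vertex n, linkCost (a / c) (b / c) (T v.1 v.2)) * partitionFunction n a b c := by
  obtain ⟨s, hs⟩ := exists_erase hT
  have hw : ∀ x (hx : x ∈ A), weight a b c x =
      (∏ v : Vertex n, linkCost (a / c) (b / c) (T v.1 v.2)) *
        weight a b c ⟨fun e => x.1 e ^^ s e, (hs x.1 x.2 (hA x hx)).1⟩ := fun x hx => by
    unfold weight
    rw [← Finset.prod_mul_distrib]
    refine Finset.prod_congr rfl fun v _ => ?_
    rw [vertexWeight_eq, vertexWeight_eq, (hs x.1 x.2 (hA x hx)).2]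
    by_cases h : T v.1 v.2 = none
    · rw [if_pos h, h]
      simp [linkCost]
    · rw [if_neg h, hA x hx v h]
      rcases hT' : T v.1 v.2 with _ | _ | _
      · exact absurd hT' h
      · simp [linkCost, hc.ne']
      · simp [linkCost, hc.ne']
  have hρ : 0 ≤ ∏ v : Vertex n, linkCost (a / c) (b / c) (T v.1 v.2) := by
    refine Finset.prod_nonneg fun v _ => ?_
    rcases T v.1 v.2 with _ | _ | _ <;> simp only [linkCost] <;> positivity
  rw [← Finset.sum_attach, Finset.sum_congr rfl fun x _ => hw x.1 x.2, ← Finset.mul_sum]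
  refine mul_le_mul_of_nonneg_left ?_ hρ
  have hinj : Function.Injective fun x : {x // x ∈ A} =>
      (⟨fun e => x.1.1 e ^^ s e, (hs x.1.1 x.1.2 (hA x.1 x.2)).1⟩ : State n) := by
    intro x y hxy
    have h := congrArg Subtype.val hxy
    refine Subtype.ext (Subtype.ext (funext fun e => ?_))
    simpa using congrFun h e
  refine (Finset.sum_map A.attach ⟨_, hinj⟩ (fun y => weight a b c y)).symm.trans_le ?_
  exact Finset.sum_le_sum_of_subset_of_nonneg (Finset.subset_univ _)
    fun y _ _ => (weight_pos ha hb hc y).le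

/-! ## Nonbacktracking walks -/

/-- The four diagonal directions: the components say whether the direction is east and whether it
is north. -/
abbrev Dir := Bool × Bool

/-- The opposite direction. -/
def Dir.opp (d : Dir) : Dir := (!d.1, !d.2)

/-- The relative cost of a step. -/
def Dir.cost (α β : ℝ) (d : Dir) : ℝ := linkCost α β (some (d.1 == d.2))

/-- The lists of `k` directions without backtracking, after a step in direction `d`. -/
def nonbacktracking : ℕ → Dir → Finset (List Dir)
  | 0, _ => {[]}
  | k + 1, d => (Finset.univ.filter fun d' => d' ≠ d.opp).biUnion fun d' =>
      (nonbacktracking k d').image (List.cons d')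

theorem mem_nonbacktracking {l : List Dir} {d : Dir}
    (h : (d :: l).IsChain fun d d' => d' ≠ d.opp) : l ∈ nonbacktracking l.length d := by
  induction l generalizing d with
  | nil => simp [nonbacktracking]
  | cons d' l ih =>
    rw [List.isChain_cons_cons] at h
    simp only [nonbacktracking, List.length_cons, Finset.mem_biUnion, Finset.mem_filter,
      Finset.mem_univ, true_and, Finset.mem_image]
    exact ⟨d', h.1, l, ih h.2, rfl⟩

theorem sum_nonbacktracking_succ (α β : ℝ) (k : ℕ) (d : Dir) :
    ∑ l ∈ nonbacktracking (k + 1) d, (l.map (Dir.cost α β)).prod =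
      ∑ d' ∈ Finset.univ.filter (fun d' => d' ≠ d.opp),
        Dir.cost α β d' * ∑ l ∈ nonbacktracking k d', (l.map (Dir.cost α β)).prod := by
  rw [nonbacktracking, Finset.sum_biUnion]
  · refine Finset.sum_congr rfl fun d' _ => ?_
    rw [Finset.sum_image fun l _ l' _ h => (List.cons.inj h).2, Finset.mul_sum]
    simp
  · intro d₁ _ d₂ _ hne
    rw [Function.onFun, Finset.disjoint_left]
    intro l h1 h2
    obtain ⟨l₁, _, rfl⟩ := Finset.mem_image.1 h1
    obtain ⟨l₂, _, h⟩ := Finset.mem_image.1 h2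
    exact hne (List.cons.inj h).1.symm

/-- The weighted number of nonbacktracking walks decays exponentially. -/
theorem exists_sum_nonbacktracking_le {α β : ℝ} (hα : 0 < α) (hβ : 0 < β)
    (h : α + β + 3 * α * β < 1) : ∃ θ : ℝ, 0 < θ ∧ θ < 1 ∧ ∀ k d,
      ∑ l ∈ nonbacktracking k d, (l.map (Dir.cost α β)).prod ≤ (1 + α + β) * θ ^ k := by
  -- After an `a`-step the admissible next steps are one `a`-step and two `b`-steps; after a
  -- `b`-step, two `a`-steps and one `b`-step. The vector (1 + β, 1 + α) is a test vector for this
  -- transfer matrix [[α, 2β], [2α, β]], and `θ` is the larger of the two growth ratios.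
  set θ := max ((α * (1 + β) + 2 * β * (1 + α)) / (1 + β))
    ((2 * α * (1 + β) + β * (1 + α)) / (1 + α)) with hθ
  have hp : 0 < 1 + β := by positivity
  have hq : 0 < 1 + α := by positivity
  have h1 : α * (1 + β) + 2 * β * (1 + α) ≤ θ * (1 + β) := by
    rw [← div_le_iff₀ hp]; exact le_max_left _ _
  have h2 : 2 * α * (1 + β) + β * (1 + α) ≤ θ * (1 + α) := by
    rw [← div_le_iff₀ hq]; exact le_max_right _ _
  have hθ0 : 0 < θ := lt_of_lt_of_le (by positivity) (le_max_left _ _)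
  refine ⟨θ, hθ0, ?_, ?_⟩
  · rw [hθ, max_lt_iff, div_lt_one hp, div_lt_one hq]
    -- Expanded, each of the two inequalities is exactly α + β + 3αβ < 1.
    constructor <;> nlinarith
  have key : ∀ k d, ∑ l ∈ nonbacktracking k d, (l.map (Dir.cost α β)).prod ≤
      (if d.1 == d.2 then 1 + β else 1 + α) * θ ^ k := by
    intro k
    induction k with
    | zero => intro d; simp [nonbacktracking]; split_ifs <;> linarith
    | succ k ih =>
      intro d
      rw [sum_nonbacktracking_succ]
      have hc : ∀ d, 0 ≤ Dir.cost α β d := by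
        intro d; unfold Dir.cost; rcases d.1 == d.2 <;> simp only [linkCost] <;> positivity
      refine (Finset.sum_le_sum fun d' _ => mul_le_mul_of_nonneg_left (ih d') (hc d')).trans ?_
      have hk := pow_pos hθ0 k
      have h1' := mul_le_mul_of_nonneg_right h1 hk.le
      have h2' := mul_le_mul_of_nonneg_right h2 hk.le
      rw [Finset.sum_filter, Fintype.sum_prod_type]
      simp only [Fintype.sum_bool]
      rcases d with ⟨_ | _, _ | _⟩ <;> simp [Dir.opp, Dir.cost, linkCost, pow_succ] <;> nlinarith
  intro k d
  refine (key k d).trans (mul_le_mul_of_nonneg_right ?_ (pow_nonneg hθ0.le k))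
  split_ifs <;> linarith

/-! ## Contours as trails in a graph of cells -/

/-- A link `(i, j, d)` joins two diagonally adjacent cells across the vertex `(i, j)`, in the
north-east direction if `d` is true and in the north-west direction otherwise. -/
abbrev Link := ℕ × ℕ × Bool

/-- The pair of cells joined by a link. -/
def linkEdge (τ : Link) : Sym2 (ℕ × ℕ) :=
  if τ.2.2 then s((τ.1, τ.2.1), (τ.1 + 1, τ.2.1 + 1)) else s((τ.1 + 1, τ.2.1), (τ.1, τ.2.1 + 1))

theorem linkEdge_injective : Function.Injective linkEdge := by
  rintro ⟨i, j, _ | _⟩ ⟨i', j', _ | _⟩ h <;> simp [linkEdge] at h ⊢ <;> omega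

/-- The graph formed by the cells and the links in `T`. -/
def linkGraph (T : ℕ → ℕ → Option Bool) : SimpleGraph (ℕ × ℕ) where
  Adj u w := ∃ τ : Link, T τ.1 τ.2.1 = some τ.2.2 ∧ linkEdge τ = s(u, w)
  symm := ⟨fun u w ⟨τ, h1, h2⟩ => ⟨τ, h1, h2.trans Sym2.eq_swap⟩⟩
  loopless := ⟨by
    rintro u ⟨⟨i, j, _ | _⟩, -, h⟩ <;> simp [linkEdge] at h <;> grind⟩

/-- The direction from `u` to `w`. -/
def dirOf (u w : ℕ × ℕ) : Dir := (decide (u.1 < w.1), decide (u.2 < w.2))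

/-- The cell reached from `u` in the direction `d`. -/
def step (u : ℕ × ℕ) (d : Dir) : ℕ × ℕ :=
  (if d.1 then u.1 + 1 else u.1 - 1, if d.2 then u.2 + 1 else u.2 - 1)

/-- The link crossed when leaving `u` in the direction `d`. -/
def linkAt (u : ℕ × ℕ) (d : Dir) : Link :=
  (if d.1 then u.1 else u.1 - 1, if d.2 then u.2 else u.2 - 1, d.1 == d.2)

/-- Along an actual link the truncated subtractions in `step` and `linkAt` are exact, so a walk can
be recovered from its start and its directions. -/
theorem eq_of_linkEdge_eq {τ : Link} {u w : ℕ × ℕ} (h : linkEdge τ = s(u, w)) :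
    w = step u (dirOf u w) ∧ τ = linkAt u (dirOf u w) := by
  obtain ⟨i, j, _ | _⟩ := τ <;> obtain ⟨u1, u2⟩ := u <;> obtain ⟨w1, w2⟩ := w <;>
    simp [linkEdge] at h <;>
    obtain ⟨⟨rfl, rfl⟩, rfl, rfl⟩ | ⟨⟨rfl, rfl⟩, rfl, rfl⟩ := h <;>
    simp [step, dirOf, linkAt]

/-- The links crossed by a walk that starts in `u` and has the directions `l`. -/
def trace : ℕ × ℕ → List Dir → List Link
  | _, [] => []
  | u, d :: l => linkAt u d :: trace (step u d) l

theorem length_trace (u : ℕ × ℕ) (l : List Dir) : (trace u l).length = l.length := by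
  induction l generalizing u with
  | nil => rfl
  | cons d l ih => simp [trace, ih]

theorem map_trace (u : ℕ × ℕ) (l : List Dir) (f : Bool → ℝ) :
    (trace u l).map (fun τ => f τ.2.2) = l.map fun d => f (d.1 == d.2) := by
  induction l generalizing u with
  | nil => rfl
  | cons d l ih => simp [trace, ih, linkAt]

/-- The links crossed by a walk, as a configuration. -/
def traceType (u : ℕ × ℕ) (l : List Dir) (i j : ℕ) : Option Bool :=
  if (i, j, true) ∈ trace u l then some true
  else if (i, j, false) ∈ trace u l then some false else none

/-- The directions of a walk. -/
def dirs {G : SimpleGraph (ℕ × ℕ)} : {u w : ℕ × ℕ} → G.Walk u w → List Dir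
  | _, _, .nil => []
  | u, _, .cons (v := v) _ p => dirOf u v :: dirs p

variable {T : ℕ → ℕ → Option Bool}

theorem edges_eq_map_trace {u w : ℕ × ℕ} (p : (linkGraph T).Walk u w) :
    p.edges = (trace u (dirs p)).map linkEdge := by
  induction p with
  | nil => rfl
  | cons h p ih =>
    have hτ := h
    obtain ⟨τ, h1, h2⟩ := hτ
    obtain ⟨h3, h4⟩ := eq_of_linkEdge_eq h2
    simp only [SimpleGraph.Walk.edges_cons, dirs, trace, List.map_cons]
    rw [← h4, ← h3, h2, ih]

theorem length_dirs {u w : ℕ × ℕ} (p : (linkGraph T).Walk u w) :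
    (dirs p).length = p.length := by
  induction p with
  | nil => rfl
  | cons h p ih => simp [dirs, ih]

theorem type_of_mem_trace {u w : ℕ × ℕ} (p : (linkGraph T).Walk u w) {τ : Link}
    (h : τ ∈ trace u (dirs p)) : T τ.1 τ.2.1 = some τ.2.2 := by
  have h1 : linkEdge τ ∈ p.edges := by
    rw [edges_eq_map_trace]; exact List.mem_map_of_mem h
  have h2 := p.edges_subset_edgeSet h1
  revert h2
  induction hτ : linkEdge τ with | _ u w =>
  rintro ⟨σ, h3, h4⟩
  rwa [linkEdge_injective (hτ.trans h4.symm)]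

theorem nodup_trace {u w : ℕ × ℕ} {p : (linkGraph T).Walk u w} (hp : p.IsTrail) :
    (trace u (dirs p)).Nodup := by
  have := hp.edges_nodup
  rw [edges_eq_map_trace] at this
  exact this.of_map _

/-- A vertex carries at most one link, so distinct links of a trail sit at distinct vertices. This
bounds the length of trails by n² and lets the costs multiply without repetition. -/
theorem nodup_map_trace {u w : ℕ × ℕ} {p : (linkGraph T).Walk u w} (hp : p.IsTrail) :
    ((trace u (dirs p)).map fun τ => (τ.1, τ.2.1)).Nodup := by
  refine (nodup_trace hp).map_on fun τ h1 σ h2 h => ?_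
  have h3 := type_of_mem_trace p h1
  have h4 := type_of_mem_trace p h2
  obtain ⟨i, j, d⟩ := τ
  obtain ⟨i', j', d'⟩ := σ
  simp only [Prod.mk.injEq] at h
  obtain ⟨rfl, rfl⟩ := h
  simp only at h3 h4
  rw [h3] at h4
  cases h4
  rfl

theorem traceType_eq_some_iff {u w : ℕ × ℕ} (p : (linkGraph T).Walk u w) (τ : Link) :
    traceType u (dirs p) τ.1 τ.2.1 = some τ.2.2 ↔ τ ∈ trace u (dirs p) := by
  obtain ⟨i, j, d⟩ := τ
  have key : (i, j, true) ∈ trace u (dirs p) → (i, j, false) ∉ trace u (dirs p) := fun h1 h2 => by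
    have h3 := type_of_mem_trace p h1
    have h4 := type_of_mem_trace p h2
    simp only at h3 h4
    rw [h3] at h4
    cases h4
  unfold traceType
  cases d <;> split_ifs <;> simp_all

theorem isChain_dirs {u w : ℕ × ℕ} {p : (linkGraph T).Walk u w} (hp : p.IsTrail) :
    (dirs p).IsChain fun d d' => d' ≠ d.opp := by
  induction p with
  | nil => exact List.isChain_nil
  | @cons u v w h p ih =>
    have ih := ih hp.of_cons
    have h1 := ((SimpleGraph.Walk.isTrail_cons h p).1 hp).2
    cases p with
    | nil => exact List.isChain_singleton _
    | @cons _ v' _ h' p =>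
      refine List.isChain_cons_cons.2 ⟨fun h2 => h1 ?_, ih⟩
      have hτ := h
      have hτ' := h'
      obtain ⟨τ, -, h3⟩ := hτ
      obtain ⟨τ', -, h4⟩ := hτ'
      have h5 := (eq_of_linkEdge_eq h3).1
      have h6 := (eq_of_linkEdge_eq h4).1
      rw [h2] at h6
      have : v' = u := by
        obtain ⟨i, j, _ | _⟩ := τ <;> obtain ⟨u1, u2⟩ := u <;> obtain ⟨w1, w2⟩ := v <;>
          simp [linkEdge] at h3 <;>
          obtain ⟨⟨rfl, rfl⟩, rfl, rfl⟩ | ⟨⟨rfl, rfl⟩, rfl, rfl⟩ := h3 <;>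
          simp [h6, step, dirOf, Dir.opp]
      subst this
      simp [Sym2.eq_swap]

theorem lt_of_vertexType_ne_none {x : Orientation n} {i j : ℕ} (h : vertexType x i j ≠ none) :
    i < n ∧ j < n := by
  by_contra h'
  exact h (vertexType_eq_none h')

theorem length_le_of_isTrail (hT : ∀ i j, T i j ≠ none → i < n ∧ j < n) {u w : ℕ × ℕ}
    {p : (linkGraph T).Walk u w} (hp : p.IsTrail) : p.length ≤ n * n := by
  have h1 := nodup_map_trace hp
  have h2 := List.toFinset_card_of_nodup h1
  rw [List.length_map, length_trace, length_dirs] at h2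
  rw [← h2]
  calc _ ≤ (Finset.range n ×ˢ Finset.range n).card := Finset.card_le_card fun v hv => by
        rw [List.mem_toFinset, List.mem_map] at hv
        obtain ⟨τ, hτ, rfl⟩ := hv
        have := hT τ.1 τ.2.1 (by rw [type_of_mem_trace p hτ]; simp)
        simpa using this
    _ = n * n := by simp

theorem prod_linkCost_traceType (hT : ∀ i j, T i j ≠ none → i < n ∧ j < n) {u w : ℕ × ℕ}
    {p : (linkGraph T).Walk u w} (hp : p.IsTrail) (α β : ℝ) :
    ∏ v : Vertex n, linkCost α β (traceType u (dirs p) v.1 v.2) =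
      ((dirs p).map (Dir.cost α β)).prod := by
  have h1 : ∏ v : Vertex n, linkCost α β (traceType u (dirs p) v.1 v.2) =
      ∏ v ∈ Finset.range n ×ˢ Finset.range n, linkCost α β (traceType u (dirs p) v.1 v.2) := by
    rw [Fintype.prod_prod_type, Finset.prod_product, Finset.prod_range]
    refine Finset.prod_congr rfl fun i _ => ?_
    rw [Finset.prod_range]
  rw [h1]
  have h2 : ∏ v ∈ ((trace u (dirs p)).map fun τ => (τ.1, τ.2.1)).toFinset,
      linkCost α β (traceType u (dirs p) v.1 v.2) =
      ∏ v ∈ Finset.range n ×ˢ Finset.range n, linkCost α β (traceType u (dirs p) v.1 v.2) := by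
    refine Finset.prod_subset (fun v hv => ?_) fun v _ hv => ?_
    · rw [List.mem_toFinset, List.mem_map] at hv
      obtain ⟨τ, hτ, rfl⟩ := hv
      have := hT τ.1 τ.2.1 (by rw [type_of_mem_trace p hτ]; simp)
      simpa using this
    · rw [List.mem_toFinset, List.mem_map] at hv
      have : traceType u (dirs p) v.1 v.2 = none := by
        unfold traceType
        rw [if_neg fun h => hv ⟨_, h, rfl⟩, if_neg fun h => hv ⟨_, h, rfl⟩]
      rw [this, linkCost]
  rw [← h2, List.prod_toFinset _ (nodup_map_trace hp), List.map_map]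
  have h3 := map_trace u (dirs p) fun d => linkCost α β (some d)
  change _ = ((dirs p).map fun d => linkCost α β (some (d.1 == d.2))).prod
  rw [← h3]
  congr 1
  refine List.map_congr_left fun τ hτ => ?_
  simp only [Function.comp]
  rw [(traceType_eq_some_iff p τ).2 hτ]

/-- The number of links of a trail at a cell, modulo two. -/
theorem countP_edges_eq {u w : ℕ × ℕ} {p : (linkGraph T).Walk u w} (hp : p.IsTrail) (i j : ℕ) :
    ((p.edges.countP fun e => (i + 1, j + 1) ∈ e : ℕ) : ZMod 2) =
      ind ((i, j, true) ∈ trace u (dirs p)) + ind ((i + 1, j, false) ∈ trace u (dirs p)) +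
      ind ((i, j + 1, false) ∈ trace u (dirs p)) +
      ind ((i + 1, j + 1, true) ∈ trace u (dirs p)) := by
  have key : ∀ l : List Link, l.Nodup →
      ((l.countP fun τ => (i + 1, j + 1) ∈ linkEdge τ : ℕ) : ZMod 2) =
      ind ((i, j, true) ∈ l) + ind ((i + 1, j, false) ∈ l) +
      ind ((i, j + 1, false) ∈ l) + ind ((i + 1, j + 1, true) ∈ l) := by
    intro l hl
    set S : Finset Link := {(i, j, true), (i + 1, j, false), (i, j + 1, false), (i + 1, j + 1, true)}
      with hS
    have hmem : ∀ τ : Link, (i + 1, j + 1) ∈ linkEdge τ ↔ τ ∈ S := by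
      rintro ⟨i', j', _ | _⟩ <;> simp [linkEdge, hS] <;> omega
    have h1 : l.countP (fun τ => (i + 1, j + 1) ∈ linkEdge τ) = (S.filter (· ∈ l)).card := by
      rw [List.countP_eq_length_filter, ← List.toFinset_card_of_nodup (hl.filter _)]
      congr 1
      ext τ
      simp [hmem, and_comm]
    rw [h1, Finset.card_filter, hS]
    rw [Finset.sum_insert, Finset.sum_insert, Finset.sum_insert, Finset.sum_singleton]
    · push_cast
      simp only [ind]
      ring
    all_goals simp
  rw [← key _ (nodup_trace hp), edges_eq_map_trace, List.countP_map]
  rfl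

/-- An open trail uses an odd number of links at its last cell, whereas an interior cell has an even
number in total. So an unused link remains. -/
theorem exists_concat_isTrail (hT : IsEven n T) {u w : ℕ × ℕ} {p : (linkGraph T).Walk u w}
    (hp : p.IsTrail) (huw : u ≠ w) (h1 : 0 < w.1 ∧ w.1 < n) (h2 : 0 < w.2 ∧ w.2 < n) :
    ∃ w', ∃ q : (linkGraph T).Walk u w', q.IsTrail ∧ q.length = p.length + 1 := by
  obtain ⟨_ | i, _ | j⟩ := w
  · exact absurd h1.1 (lt_irrefl 0)
  · exact absurd h1.1 (lt_irrefl 0)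
  · exact absurd h2.1 (lt_irrefl 0)
  have h3 := hp.even_countP_edges_iff (i + 1, j + 1)
  have h4 : ¬ Even (p.edges.countP fun e => (i + 1, j + 1) ∈ e) := fun h =>
    (h3.1 h huw).2 rfl
  rw [← ZMod.natCast_eq_zero_iff_even, countP_edges_eq hp] at h4
  have h5 := hT i j h1.2 h2.2
  have key : ∃ τ : Link, (i + 1, j + 1) ∈ linkEdge τ ∧ T τ.1 τ.2.1 = some τ.2.2 ∧
      τ ∉ trace u (dirs p) := by
    by_contra! H
    apply h4
    rw [← h5]
    have e : ∀ τ : Link, (i + 1, j + 1) ∈ linkEdge τ →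
        ind (τ ∈ trace u (dirs p)) = ind (T τ.1 τ.2.1 = some τ.2.2) := fun τ hτ =>
      ind_congr ⟨type_of_mem_trace p, H τ hτ⟩
    rw [e _ (by simp [linkEdge]), e _ (by simp [linkEdge]), e _ (by simp [linkEdge]),
      e _ (by simp [linkEdge])]
  obtain ⟨τ, h6, h7, h8⟩ := key
  obtain ⟨w', h9⟩ := h6
  have hadj : (linkGraph T).Adj (i + 1, j + 1) w' := ⟨τ, h7, h9⟩
  refine ⟨w', p.concat hadj, ?_, SimpleGraph.Walk.length_concat _ _⟩
  rw [SimpleGraph.Walk.isTrail_def, SimpleGraph.Walk.edges_concat, List.concat_eq_append,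
    List.nodup_append]
  refine ⟨hp.edges_nodup, List.nodup_singleton _, ?_⟩
  rintro e he e' he' rfl
  rw [List.mem_singleton.1 he', edges_eq_map_trace, ← h9] at he
  obtain ⟨σ, h10, h11⟩ := List.mem_map.1 he
  exact h8 (linkEdge_injective h11 ▸ h10)

/-- A trail that cannot be extended is closed or ends on the boundary at both sides. -/
theorem exists_maximal_trail (hT : IsEven n T) (hT' : ∀ i j, T i j ≠ none → i < n ∧ j < n)
    {u w : ℕ × ℕ} (p : (linkGraph T).Walk u w) (hp : p.IsTrail) :
    ∃ u w, ∃ q : (linkGraph T).Walk u w, q.IsTrail ∧ p.length ≤ q.length ∧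
      IsEven n (traceType u (dirs q)) := by
  -- Extension terminates because trails have at most n² links.
  induction hk : n * n - p.length using Nat.strong_induction_on generalizing u w with | _ k ih =>
  have hlen := length_le_of_isTrail hT' hp
  have ext : (∃ u w, ∃ q : (linkGraph T).Walk u w, q.IsTrail ∧ q.length = p.length + 1) →
      ∃ u w, ∃ q : (linkGraph T).Walk u w, q.IsTrail ∧ p.length ≤ q.length ∧
        IsEven n (traceType u (dirs q)) := by
    rintro ⟨u', w', q, hq, hq'⟩
    have := length_le_of_isTrail hT' hq
    obtain ⟨u, w, r, h1, h2, h3⟩ := ih (n * n - q.length) (by omega) q hq rfl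
    exact ⟨u, w, r, h1, by omega, h3⟩
  by_cases huw : u = w
  swap
  · by_cases h1 : (0 < w.1 ∧ w.1 < n) ∧ (0 < w.2 ∧ w.2 < n)
    · obtain ⟨w', q, hq⟩ := exists_concat_isTrail hT hp huw h1.1 h1.2
      exact ext ⟨_, _, q, hq⟩
    by_cases h2 : (0 < u.1 ∧ u.1 < n) ∧ (0 < u.2 ∧ u.2 < n)
    · obtain ⟨w', q, hq, hq'⟩ := exists_concat_isTrail hT hp.reverse (Ne.symm huw) h2.1 h2.2
      exact ext ⟨_, _, q, hq, by rw [hq', SimpleGraph.Walk.length_reverse]⟩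
    refine ⟨u, w, p, hp, le_rfl, fun i j hi hj => ?_⟩
    rw [ind_congr (traceType_eq_some_iff p (i, j, true)),
      ind_congr (traceType_eq_some_iff p (i + 1, j, false)),
      ind_congr (traceType_eq_some_iff p (i, j + 1, false)),
      ind_congr (traceType_eq_some_iff p (i + 1, j + 1, true)), ← countP_edges_eq hp,
      ZMod.natCast_eq_zero_iff_even, hp.even_countP_edges_iff]
    rintro -
    constructor
    · rintro rfl
      exact h2 ⟨⟨by simp, by simpa⟩, by simp, by simpa⟩
    · rintro rfl
      exact h1 ⟨⟨by simp, by simpa⟩, by simp, by simpa⟩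
  · refine ⟨u, w, p, hp, le_rfl, fun i j hi hj => ?_⟩
    rw [ind_congr (traceType_eq_some_iff p (i, j, true)),
      ind_congr (traceType_eq_some_iff p (i + 1, j, false)),
      ind_congr (traceType_eq_some_iff p (i, j + 1, false)),
      ind_congr (traceType_eq_some_iff p (i + 1, j + 1, true)), ← countP_edges_eq hp,
      ZMod.natCast_eq_zero_iff_even, hp.even_countP_edges_iff]
    exact fun h => absurd huw h

/-! ## Long contours are unlikely -/

/-- The configuration has a contour of length at least `L`. -/
def HasLongContour (L : ℕ) (x : Orientation n) : Prop :=
  ∃ u w, ∃ p : (linkGraph (vertexType x)).Walk u w, p.IsTrail ∧ L ≤ p.length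

/-- A contour that starts in `u` and has the directions `l` can be erased. -/
def HasErasableContour (u : ℕ × ℕ) (l : List Dir) (x : Orientation n) : Prop :=
  ∃ w, ∃ p : (linkGraph (vertexType x)).Walk u w, p.IsTrail ∧ dirs p = l ∧
    IsEven n (traceType u l)

open Classical in
-- The links to be erased are determined by `u` and `l`, so one erasing map serves all these states.
-- A single witness shows that the walk is a trail, which turns the product over vertices into a
-- product over steps; without a witness the sum is empty.
theorem sum_weight_erasable_le {a b c : ℝ} (ha : 0 < a) (hb : 0 < b) (hc : 0 < c)
    (u : ℕ × ℕ) (l : List Dir) :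
    ∑ x : State n with HasErasableContour u l x.1, weight a b c x ≤
      (l.map (Dir.cost (a / c) (b / c))).prod * partitionFunction n a b c := by
  by_cases h : ∃ x : State n, HasErasableContour u l x.1
  · obtain ⟨x, w, p, hp, rfl, he⟩ := h
    rw [← prod_linkCost_traceType (fun i j => lt_of_vertexType_ne_none) hp]
    refine sum_weight_carries_le ha hb hc he _ fun y hy v hv => ?_
    obtain ⟨w', q, -, hq', -⟩ := (Finset.mem_filter.1 hy).2
    rw [← hq'] at hv ⊢
    obtain ⟨d, hd⟩ := Option.ne_none_iff_exists'.1 hv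
    rw [hd]
    exact type_of_mem_trace q ((traceType_eq_some_iff q (v.1, v.2, d)).1 hd)
  · rw [Finset.filter_false_of_mem fun x _ hx => h ⟨x, hx⟩, Finset.sum_empty]
    refine mul_nonneg (List.prod_nonneg fun r hr => ?_) (partitionFunction_pos ha hb hc).le
    obtain ⟨d, -, rfl⟩ := List.mem_map.1 hr
    unfold Dir.cost
    rcases d.1 == d.2 <;> simp only [linkCost] <;> positivity

theorem le_of_adj {x : Orientation n} {u w : ℕ × ℕ} (h : (linkGraph (vertexType x)).Adj u w) :
    u.1 ≤ n ∧ u.2 ≤ n := by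
  obtain ⟨⟨i, j, d⟩, h1, h2⟩ := h
  have h3 := lt_of_vertexType_ne_none (x := x) (i := i) (j := j) (by rw [h1]; simp)
  cases d <;> simp [linkEdge] at h2 <;> grind

/-- A long trail need not be erasable itself, but a maximal one of at least its length is. -/
theorem HasLongContour.exists_erasable {x : Orientation n} (hx : IceRule x) {L : ℕ} (hL : 1 ≤ L)
    (h : HasLongContour L x) : ∃ u ∈ Finset.range (n + 1) ×ˢ Finset.range (n + 1),
      ∃ k ∈ Finset.Icc L (n * n), ∃ d, ∃ l ∈ nonbacktracking k d, HasErasableContour u l x := by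
  obtain ⟨u, w, p, hp, hpL⟩ := h
  obtain ⟨u, w, q, hq, hpq, he⟩ :=
    exists_maximal_trail (isEven_vertexType hx) (fun i j => lt_of_vertexType_ne_none) p hp
  have hlen := length_le_of_isTrail (fun i j => lt_of_vertexType_ne_none) hq
  refine ⟨u, ?_, q.length, Finset.mem_Icc.2 ⟨hpL.trans hpq, hlen⟩, ?_⟩
  · cases q with
    | nil => simp only [SimpleGraph.Walk.length_nil] at hpq; omega
    | cons hadj q =>
      have := le_of_adj hadj
      simp only [Finset.mem_product, Finset.mem_range]
      omega
  · have h1 := isChain_dirs hq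
    -- `nonbacktracking` expects a preceding direction. The first direction of the trail itself
    -- serves, since no direction is its own opposite.
    refine ⟨(dirs q).headD (true, true), dirs q, ?_, w, q, hq, rfl, he⟩
    rw [← length_dirs]
    apply mem_nonbacktracking
    generalize dirs q = l at *
    cases l with
    | nil => exact List.isChain_singleton _
    | cons d l =>
      refine List.isChain_cons_cons.2 ⟨?_, h1⟩
      rcases d with ⟨_ | _, _ | _⟩ <;> simp [Dir.opp]

open Classical in
-- Union bound over (n + 1)² starting cells, at most n² + 1 lengths and four fictitious preceding
-- directions.
theorem sum_weight_longContour_le {a b c : ℝ} (ha : 0 < a) (hb : 0 < b) (hc : 0 < c) {θ C : ℝ}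
    (hθ0 : 0 < θ) (hθ1 : θ < 1) (hC : 0 ≤ C) (hθ : ∀ k d, ∑ l ∈ nonbacktracking k d,
      (l.map (Dir.cost (a / c) (b / c))).prod ≤ C * θ ^ k) {L : ℕ} (hL : 1 ≤ L) :
    ∑ x : State n with HasLongContour L x.1, weight a b c x ≤
      4 * (n + 1) ^ 4 * (C * θ ^ L) * partitionFunction n a b c := by
  have hZ := partitionFunction_pos (n := n) ha hb hc
  set U := Finset.range (n + 1) ×ˢ Finset.range (n + 1) with hU
  have h1 : ∀ x ∈ Finset.univ.filter fun x : State n => HasLongContour L x.1,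
      weight a b c x ≤ ∑ u ∈ U, ∑ k ∈ Finset.Icc L (n * n), ∑ d : Dir, ∑ l ∈ nonbacktracking k d,
        if HasErasableContour u l x.1 then weight a b c x else 0 := by
    intro x hx
    obtain ⟨u, hu, k, hk, d, l, hl, he⟩ :=
      HasLongContour.exists_erasable x.2 hL (Finset.mem_filter.1 hx).2
    have hw := (weight_pos ha hb hc x).le
    have h0 : ∀ u l, 0 ≤ if HasErasableContour u l x.1 then weight a b c x else 0 := fun u l => by
      split_ifs
      · exact hw
      · exact le_rfl
    calc weight a b c x = if HasErasableContour u l x.1 then weight a b c x else 0 :=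
          (if_pos he).symm
      _ ≤ ∑ l ∈ nonbacktracking k d, if HasErasableContour u l x.1 then weight a b c x else 0 :=
          Finset.single_le_sum (f := fun l =>
            if HasErasableContour u l x.1 then weight a b c x else 0) (fun l _ => h0 u l) hl
      _ ≤ ∑ d : Dir, ∑ l ∈ nonbacktracking k d,
            if HasErasableContour u l x.1 then weight a b c x else 0 :=
          Finset.single_le_sum (f := fun d => ∑ l ∈ nonbacktracking k d,
            if HasErasableContour u l x.1 then weight a b c x else 0)
            (fun d _ => Finset.sum_nonneg fun l _ => h0 u l) (Finset.mem_univ d)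
      _ ≤ ∑ k ∈ Finset.Icc L (n * n), ∑ d : Dir, ∑ l ∈ nonbacktracking k d,
            if HasErasableContour u l x.1 then weight a b c x else 0 :=
          Finset.single_le_sum (f := fun k => ∑ d : Dir, ∑ l ∈ nonbacktracking k d,
            if HasErasableContour u l x.1 then weight a b c x else 0)
            (fun k _ => Finset.sum_nonneg fun d _ => Finset.sum_nonneg fun l _ => h0 u l) hk
      _ ≤ _ :=
          Finset.single_le_sum (f := fun u => ∑ k ∈ Finset.Icc L (n * n), ∑ d : Dir,
            ∑ l ∈ nonbacktracking k d, if HasErasableContour u l x.1 then weight a b c x else 0)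
            (fun u _ => Finset.sum_nonneg fun k _ => Finset.sum_nonneg fun d _ =>
              Finset.sum_nonneg fun l _ => h0 u l) hu
  refine (Finset.sum_le_sum h1).trans ((Finset.sum_le_sum_of_subset_of_nonneg
    (Finset.subset_univ _) fun x _ _ => ?_).trans ?_)
  · refine Finset.sum_nonneg fun u _ => Finset.sum_nonneg fun k _ => Finset.sum_nonneg fun d _ =>
      Finset.sum_nonneg fun l _ => ?_
    split_ifs
    · exact (weight_pos ha hb hc x).le
    · exact le_rfl
  rw [Finset.sum_comm]
  have h2 : ∀ u ∈ U, ∑ x : State n, ∑ k ∈ Finset.Icc L (n * n), ∑ d : Dir,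
      ∑ l ∈ nonbacktracking k d, (if HasErasableContour u l x.1 then weight a b c x else 0) ≤
      (n * n + 1) * (4 * (C * θ ^ L * partitionFunction n a b c)) := by
    intro u _
    rw [Finset.sum_comm]
    have h3 : ∀ k ∈ Finset.Icc L (n * n), ∑ x : State n, ∑ d : Dir,
        ∑ l ∈ nonbacktracking k d, (if HasErasableContour u l x.1 then weight a b c x else 0) ≤
        4 * (C * θ ^ L * partitionFunction n a b c) := by
      intro k hk
      rw [Finset.sum_comm]
      have h4 : ∀ d ∈ (Finset.univ : Finset Dir), ∑ x : State n,
          ∑ l ∈ nonbacktracking k d, (if HasErasableContour u l x.1 then weight a b c x else 0) ≤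
          C * θ ^ L * partitionFunction n a b c := by
        intro d _
        rw [Finset.sum_comm]
        simp_rw [← Finset.sum_filter]
        refine (Finset.sum_le_sum fun l _ => sum_weight_erasable_le ha hb hc u l).trans ?_
        rw [← Finset.sum_mul]
        refine mul_le_mul_of_nonneg_right ((hθ k d).trans ?_) hZ.le
        exact mul_le_mul_of_nonneg_left
          (pow_le_pow_of_le_one hθ0.le hθ1.le (Finset.mem_Icc.1 hk).1) hC
      refine (Finset.sum_le_card_nsmul _ _ _ h4).trans_eq ?_
      rw [nsmul_eq_mul]
      norm_num
    refine (Finset.sum_le_card_nsmul _ _ _ h3).trans ?_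
    rw [nsmul_eq_mul]
    refine mul_le_mul_of_nonneg_right ?_ (by positivity)
    have : (Finset.Icc L (n * n)).card ≤ n * n + 1 := by rw [Nat.card_Icc]; omega
    exact_mod_cast this
  refine (Finset.sum_le_card_nsmul _ _ _ h2).trans ?_
  rw [nsmul_eq_mul, hU, Finset.card_product, Finset.card_range]
  have hX : 0 ≤ C * θ ^ L * partitionFunction n a b c := by positivity
  have hn : (0 : ℝ) ≤ n := Nat.cast_nonneg n
  calc (((n + 1) * (n + 1) : ℕ) : ℝ) * ((n * n + 1) * (4 * (C * θ ^ L * partitionFunction n a b c)))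
      = (n + 1) ^ 2 * (n * n + 1) * (4 * (C * θ ^ L * partitionFunction n a b c)) := by
        push_cast; ring
    _ ≤ (n + 1) ^ 2 * (n + 1) ^ 2 * (4 * (C * θ ^ L * partitionFunction n a b c)) := by
        refine mul_le_mul_of_nonneg_right (mul_le_mul_of_nonneg_left ?_ (by positivity))
          (by positivity)
        nlinarith
    _ = _ := by ring

/-! ## The background of a configuration without long contours -/

section Background

open Classical

variable {T T' : ℕ → ℕ → Option Bool}

/-- The links of `T` between cells in `M`. -/
def restrict (T : ℕ → ℕ → Option Bool) (M : Set (ℕ × ℕ)) (i j : ℕ) : Option Bool :=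
  -- Membership is tested at the lower end of the link; if `M` is a union of components, the upper
  -- end gives the same answer.
  if (if T i j = some true then i else i + 1, j) ∈ M then T i j else none

theorem restrict_true_iff {M : Set (ℕ × ℕ)} {i j : ℕ} :
    restrict T M i j = some true ↔ T i j = some true ∧ (i, j) ∈ M := by
  unfold restrict
  rcases T i j with _ | _ | _ <;> simp

theorem restrict_false_iff {M : Set (ℕ × ℕ)} {i j : ℕ} :
    restrict T M i j = some false ↔ T i j = some false ∧ (i + 1, j) ∈ M := by
  unfold restrict
  rcases T i j with _ | _ | _ <;> simp

theorem restrict_ne_none_iff {M : Set (ℕ × ℕ)} {i j : ℕ} :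
    restrict T M i j ≠ none ↔
      T i j ≠ none ∧ (if T i j = some true then i else i + 1, j) ∈ M := by
  unfold restrict
  split_ifs <;> simp_all

/-- `M` is a union of components. -/
def IsClosedIn (T : ℕ → ℕ → Option Bool) (M : Set (ℕ × ℕ)) : Prop :=
  ∀ u w, (linkGraph T).Adj u w → u ∈ M → w ∈ M

theorem adj_of_true {i j : ℕ} (h : T i j = some true) :
    (linkGraph T).Adj (i, j) (i + 1, j + 1) := ⟨(i, j, true), h, rfl⟩

theorem adj_of_false {i j : ℕ} (h : T i j = some false) :
    (linkGraph T).Adj (i + 1, j) (i, j + 1) := ⟨(i, j, false), h, rfl⟩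

theorem IsClosedIn.restrict_true_iff {M : Set (ℕ × ℕ)} (hM : IsClosedIn T M) {i j : ℕ} :
    restrict T M i j = some true ↔ T i j = some true ∧ (i + 1, j + 1) ∈ M := by
  rw [SixVertex.restrict_true_iff]
  exact and_congr_right fun h => ⟨hM _ _ (adj_of_true h), hM _ _ (adj_of_true h).symm⟩

theorem IsClosedIn.restrict_false_iff {M : Set (ℕ × ℕ)} (hM : IsClosedIn T M) {i j : ℕ} :
    restrict T M i j = some false ↔ T i j = some false ∧ (i, j + 1) ∈ M := by
  rw [SixVertex.restrict_false_iff]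
  exact and_congr_right fun h => ⟨hM _ _ (adj_of_false h), hM _ _ (adj_of_false h).symm⟩

theorem IsEven.restrict (hT : IsEven n T) {M : Set (ℕ × ℕ)} (hM : IsClosedIn T M) :
    IsEven n (restrict T M) := by
  intro i j hi hj
  rw [ind_congr hM.restrict_true_iff, ind_congr (hM.restrict_false_iff (i := i + 1) (j := j)),
    ind_congr (SixVertex.restrict_false_iff (i := i) (j := j + 1)),
    ind_congr (SixVertex.restrict_true_iff (i := i + 1) (j := j + 1))]
  by_cases h : (i + 1, j + 1) ∈ M
  · simpa only [h, and_true] using hT i j hi hj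
  · simp [h, ind]

/-- The number of links of `M` in the lowest row, modulo two. -/
def rowParity (n : ℕ) (T : ℕ → ℕ → Option Bool) (M : Set (ℕ × ℕ)) : ZMod 2 :=
  ∑ i ∈ Finset.range n, ind (restrict T M i 0 ≠ none)

theorem rowParity_split (M N : Set (ℕ × ℕ)) :
    rowParity n T M = rowParity n T (M ∩ N) + rowParity n T (M \ N) := by
  unfold rowParity
  rw [← Finset.sum_add_distrib]
  refine Finset.sum_congr rfl fun i _ => ?_
  rw [ind_congr restrict_ne_none_iff, ind_congr restrict_ne_none_iff,
    ind_congr restrict_ne_none_iff]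
  simp only [Set.mem_inter_iff, Set.mem_sdiff, ind]
  split_ifs <;> simp_all

/-- Contours that avoid the left and right sides cross all rows of vertices with the same parity,
and those that avoid the top do not cross the highest row. -/
theorem rowParity_eq_zero (hT : IsEven n T) {M : Set (ℕ × ℕ)} (hM : IsClosedIn T M)
    (h0 : ∀ u ∈ M, 0 < u.1) (h1 : ∀ u ∈ M, u.1 < n) (h2 : ∀ u ∈ M, u.2 < n) :
    rowParity n T M = 0 := by
  have hR := hT.restrict hM
  have hrow : ∀ r, r + 1 < n → ∑ i ∈ Finset.range n, ind (restrict T M i r ≠ none) =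
      ∑ i ∈ Finset.range n, ind (restrict T M i (r + 1) ≠ none) := by
    intro r hr
    obtain ⟨m, rfl⟩ : ∃ m, n = m + 1 := ⟨n - 1, by omega⟩
    have h3 := hR.sum_two_rows hr (Nat.lt_succ_self m)
    have e : ∀ {o : Prop} [Decidable o], ¬ o → ind o = 0 := fun h => if_neg h
    rw [e fun h => lt_irrefl 0 (h0 _ (hM.restrict_false_iff.1 h).2),
      e fun h => lt_irrefl 0 (h0 _ (restrict_true_iff.1 h).2)] at h3
    rw [Finset.sum_range_succ, Finset.sum_range_succ, ind_ne_none (restrict T M m r),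
      ind_ne_none (restrict T M m (r + 1)),
      e fun h => lt_irrefl (m + 1) (h1 _ (hM.restrict_true_iff.1 h).2),
      e fun h => lt_irrefl (m + 1) (h1 _ (restrict_false_iff (j := r + 1) |>.1 h).2)]
    generalize ∑ i ∈ Finset.range m, ind (restrict T M i r ≠ none) = A at *
    generalize ∑ i ∈ Finset.range m, ind (restrict T M i (r + 1) ≠ none) = B at *
    grind
  rcases Nat.eq_zero_or_pos n with rfl | hn
  · simp [rowParity]
  have hall : ∀ r, r < n → rowParity n T M =
      ∑ i ∈ Finset.range n, ind (restrict T M i r ≠ none) := by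
    intro r
    induction r with
    | zero => exact fun _ => rfl
    | succ r ih => exact fun hr => (ih (by omega)).trans (hrow r hr)
  rw [hall (n - 1) (by omega)]
  refine Finset.sum_eq_zero fun i _ => if_neg ?_
  rw [not_not]
  have hn' : n - 1 + 1 = n := by omega
  rcases h : restrict T M i (n - 1) with _ | _ | _
  · rfl
  · have := h2 _ (hM.restrict_false_iff.1 h).2
    simp only at this; omega
  · have := h2 _ (hM.restrict_true_iff.1 h).2
    simp only at this; omega

/-- The cells linked to the left boundary. -/
def leftCells (T : ℕ → ℕ → Option Bool) : Set (ℕ × ℕ) :=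
  {g | ∃ r, (linkGraph T).Reachable g (0, r)}

/-- Two cells are equal or share an edge or a corner. -/
def IsNear (f g : ℕ × ℕ) : Prop :=
  (f.1 ≤ g.1 + 1 ∧ g.1 ≤ f.1 + 1) ∧ f.2 ≤ g.2 + 1 ∧ g.2 ≤ f.2 + 1

/-- The cells linked to the neighbourhood of `f`. -/
def nearCells (T : ℕ → ℕ → Option Bool) (f : ℕ × ℕ) : Set (ℕ × ℕ) :=
  {g | ∃ h, IsNear f h ∧ (linkGraph T).Reachable g h}

theorem isClosedIn_leftCells : IsClosedIn T (leftCells T) :=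
  fun _ _ h ⟨r, hr⟩ => ⟨r, h.symm.reachable.trans hr⟩

theorem isClosedIn_nearCells (f : ℕ × ℕ) : IsClosedIn T (nearCells T f) :=
  fun _ _ h ⟨g, hg, hr⟩ => ⟨g, hg, h.symm.reachable.trans hr⟩

theorem mem_nearCells_of_isNear {f g : ℕ × ℕ} (h : IsNear f g) : g ∈ nearCells T f :=
  ⟨g, h, .refl _⟩

theorem IsClosedIn.diff {M N : Set (ℕ × ℕ)} (hM : IsClosedIn T M) (hN : IsClosedIn T N) :
    IsClosedIn T (M \ N) :=
  fun u w h hu => ⟨hM u w h hu.1, fun hw => hu.2 (hN w u h.symm hw)⟩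

/-- `T` and `T'` differ at most at the corners of the cell `f`. -/
def AgreeOff (f : ℕ × ℕ) (T T' : ℕ → ℕ → Option Bool) : Prop :=
  ∀ i j, ¬ ((f.1 = i ∨ f.1 = i + 1) ∧ (f.2 = j ∨ f.2 = j + 1)) → T i j = T' i j

theorem AgreeOff.symm {f : ℕ × ℕ} (h : AgreeOff f T T') : AgreeOff f T' T :=
  fun i j hij => (h i j hij).symm

/-- Every changed link has both ends in the neighbourhood of `f`, so components that avoid this
neighbourhood are the same for `T` and `T'`. -/
theorem AgreeOff.reachable {f : ℕ × ℕ} (h : AgreeOff f T T') {g g' : ℕ × ℕ}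
    (hg : g ∉ nearCells T f) (hr : (linkGraph T').Reachable g g') :
    (linkGraph T).Reachable g g' := by
  obtain ⟨p⟩ := hr
  induction p with
  | nil => exact .refl _
  | @cons u v w hadj p ih =>
    obtain ⟨⟨i, j, d⟩, h1, h2⟩ := hadj
    have h3 : ¬ ((f.1 = i ∨ f.1 = i + 1) ∧ (f.2 = j ∨ f.2 = j + 1)) := by
      intro h3
      refine hg (mem_nearCells_of_isNear ?_)
      unfold IsNear
      cases d <;> simp [linkEdge] at h2 <;> grind
    have h4 : (linkGraph T).Adj u v := ⟨(i, j, d), (h i j h3).trans h1, h2⟩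
    exact h4.reachable.trans (ih fun hv => hg (isClosedIn_nearCells f _ _ h4.symm hv))

theorem AgreeOff.not_mem_nearCells {f : ℕ × ℕ} (h : AgreeOff f T T') {g : ℕ × ℕ}
    (hg : g ∉ nearCells T f) : g ∉ nearCells T' f :=
  fun ⟨h', hn, hr⟩ => hg ⟨h', hn, h.reachable hg hr⟩

theorem AgreeOff.restrict_ne_none {f : ℕ × ℕ} (h : AgreeOff f T T') {M M' : Set (ℕ × ℕ)} {i j : ℕ}
    (hM : ∀ g ∉ nearCells T f, g ∈ M → g ∈ M')
    (hi : restrict T (M \ nearCells T f) i j ≠ none) :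
    restrict T' (M' \ nearCells T' f) i j ≠ none := by
  rw [restrict_ne_none_iff] at hi ⊢
  obtain ⟨h1, h2, h3⟩ := hi
  have h4 : ¬ ((f.1 = i ∨ f.1 = i + 1) ∧ (f.2 = j ∨ f.2 = j + 1)) := by
    intro h4
    refine h3 (mem_nearCells_of_isNear ?_)
    unfold IsNear
    split_ifs <;> grind
  rw [← h i j h4]
  exact ⟨h1, hM _ h3 h2, h.not_mem_nearCells h3⟩

theorem AgreeOff.rowParity_diff {f : ℕ × ℕ} (h : AgreeOff f T T') {M M' : Set (ℕ × ℕ)}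
    (hM : ∀ g ∉ nearCells T f, g ∈ M → g ∈ M') (hM' : ∀ g ∉ nearCells T' f, g ∈ M' → g ∈ M) :
    rowParity n T (M \ nearCells T f) = rowParity n T' (M' \ nearCells T' f) :=
  Finset.sum_congr rfl fun _ _ =>
    ind_congr ⟨h.restrict_ne_none hM, h.symm.restrict_ne_none hM'⟩

theorem AgreeOff.mem_leftCells {f : ℕ × ℕ} (h : AgreeOff f T T') {g : ℕ × ℕ}
    (hg : g ∉ nearCells T f) (h' : g ∈ leftCells T) : g ∈ leftCells T' :=
  h'.imp fun _ hr => h.symm.reachable (h.not_mem_nearCells hg) hr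

theorem dist_le_length {u w : ℕ × ℕ} (p : (linkGraph T).Walk u w) :
    (u.1 ≤ w.1 + p.length ∧ w.1 ≤ u.1 + p.length) ∧
      u.2 ≤ w.2 + p.length ∧ w.2 ≤ u.2 + p.length := by
  induction p with
  | nil => simp
  | @cons u v w h p ih =>
    have hτ := h
    obtain ⟨⟨i, j, d⟩, -, h2⟩ := hτ
    rw [SimpleGraph.Walk.length_cons]
    cases d <;> simp [linkEdge] at h2 <;> grind

/-- All trails have length less than `L`. -/
def HasShortTrails (L : ℕ) (T : ℕ → ℕ → Option Bool) : Prop :=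
  ∀ u w, ∀ p : (linkGraph T).Walk u w, p.IsTrail → p.length < L

/-- A path has at most L - 1 links, and the neighbourhood of `f` adds one more unit of distance. -/
theorem HasShortTrails.dist_le {L : ℕ} (hT : HasShortTrails L T) {f g : ℕ × ℕ}
    (hg : g ∈ nearCells T f) :
    (f.1 ≤ g.1 + L ∧ g.1 ≤ f.1 + L) ∧ f.2 ≤ g.2 + L ∧ g.2 ≤ f.2 + L := by
  obtain ⟨h, h1, hr⟩ := hg
  obtain ⟨p, hp⟩ := hr.exists_isPath
  have h2 := hT _ _ p hp.isTrail
  have h3 := dist_le_length p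
  unfold IsNear at h1
  omega

/-- A component that comes near `f` and meets both the left side and the lowest row would force both
coordinates of `f` to be at most `L`. -/
theorem HasShortTrails.rowParity_eq {L : ℕ} (hT : HasShortTrails L T) {f : ℕ × ℕ}
    (hf : L < f.1 ∨ L < f.2) :
    rowParity n T (leftCells T) = rowParity n T (leftCells T \ nearCells T f) := by
  refine Finset.sum_congr rfl fun i _ => ind_congr ?_
  rw [restrict_ne_none_iff, restrict_ne_none_iff]
  refine and_congr_right fun _ => ⟨fun h => ⟨h, fun h' => ?_⟩, fun h => h.1⟩
  have h1 := hT.dist_le h'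
  obtain ⟨r, hr⟩ := h
  obtain ⟨g, hg, hr'⟩ := h'
  have h2 := hT.dist_le ⟨g, hg, hr.symm.trans hr'⟩
  simp only at h1 h2
  omega

/-- Components near the corner reach neither the right side nor the top, so those that also miss the
left side contribute an even number of links. -/
theorem HasShortTrails.rowParity_near {L : ℕ} (hT : HasShortTrails L T) (he : IsEven n T)
    {f : ℕ × ℕ} (h1 : f.1 ≤ L) (h2 : f.2 ≤ L) (hL : 2 * L < n) :
    rowParity n T (nearCells T f ∩ leftCells T) = rowParity n T (nearCells T f) := by
  rw [rowParity_split (nearCells T f) (leftCells T), left_eq_add]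
  refine rowParity_eq_zero he ((isClosedIn_nearCells f).diff isClosedIn_leftCells)
    (fun u hu => ?_) (fun u hu => ?_) fun u hu => ?_
  · refine Nat.pos_of_ne_zero fun h => hu.2 ⟨u.2, ?_⟩
    rw [← h]
  · have := hT.dist_le hu.1; omega
  · have := hT.dist_le hu.1; omega

/-- A local change of the links away from the corner does not affect the parity of the links in the
lowest row that belong to components touching the left boundary. -/
theorem AgreeOff.rowParity_leftCells_far {f : ℕ × ℕ} (h : AgreeOff f T T') {L : ℕ}
    (hT : HasShortTrails L T) (hT' : HasShortTrails L T') (hf : L < f.1 ∨ L < f.2) :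
    rowParity n T (leftCells T) = rowParity n T' (leftCells T') := by
  rw [hT.rowParity_eq hf, hT'.rowParity_eq hf]
  exact h.rowParity_diff (fun g => h.mem_leftCells) fun g => h.symm.mem_leftCells

/-- Near the corner, a local change of the links affects this parity as it affects the parity of
all links in the lowest row. -/
theorem AgreeOff.rowParity_leftCells_near {f : ℕ × ℕ} (h : AgreeOff f T T') {L : ℕ}
    (hT : HasShortTrails L T) (hT' : HasShortTrails L T') (he : IsEven n T) (he' : IsEven n T')
    (h1 : f.1 ≤ L) (h2 : f.2 ≤ L) (hL : 2 * L < n) :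
    rowParity n T (leftCells T) + rowParity n T' (leftCells T') =
      rowParity n T Set.univ + rowParity n T' Set.univ := by
  have e1 := h.rowParity_diff (n := n) (fun g => h.mem_leftCells) fun g => h.symm.mem_leftCells
  have e2 := h.rowParity_diff (n := n) (M := Set.univ) (M' := Set.univ) (fun _ _ _ => trivial)
    (fun _ _ _ => trivial)
  have e3 := hT.rowParity_near he h1 h2 hL
  have e4 := hT'.rowParity_near he' h1 h2 hL
  rw [rowParity_split (leftCells T) (nearCells T f), rowParity_split (leftCells T') (nearCells T' f),
    rowParity_split Set.univ (nearCells T f), rowParity_split Set.univ (nearCells T' f),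
    Set.univ_inter, Set.univ_inter, Set.inter_comm, Set.inter_comm (leftCells T'), e1, e2, e3, e4]
  generalize rowParity n T' (leftCells T' \ nearCells T' f) = A
  generalize rowParity n T' (Set.univ \ nearCells T' f) = B
  grind

end Background

/-- The westernmost edge of the lowest row. -/
def cornerEdge (hn : 0 < n) : Edge n := Sum.inl (⟨0, hn⟩, 0)

/-- The orientation of the edge in the corner, corrected for the contours around it. In the absence
of long contours it tells which of the two ground states prevails. -/
def background (hn : 0 < n) (x : Orientation n) : ZMod 2 :=
  ind (x (cornerEdge hn) = true) + rowParity n (vertexType x) (leftCells (vertexType x))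

/-- In a row, two consecutive horizontal edges agree exactly when the vertex between them carries a
link, so the links are counted by `n` minus the number of changes of direction. -/
theorem rowParity_univ (hn : 0 < n) (x : Orientation n) :
    rowParity n (vertexType x) Set.univ = n + ind (x (cornerEdge hn) = true) +
      ind (x (Sum.inl (⟨0, hn⟩, Fin.last n)) = true) := by
  have key : ∀ k (hk : k < n + 1), ∑ i ∈ Finset.range k,
      ind (restrict (vertexType x) Set.univ i 0 ≠ none) = k + ind (x (cornerEdge hn) = true) +
      ind (x (Sum.inl (⟨0, hn⟩, ⟨k, hk⟩)) = true) := by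
    intro k
    induction k with
    | zero =>
      intro hk
      have : x (Sum.inl (⟨0, hn⟩, ⟨0, hk⟩)) = x (cornerEdge hn) := rfl
      rw [this]
      generalize ind (x (cornerEdge hn) = true) = A
      simp [CharTwo.add_self_eq_zero]
    | succ k ih =>
      intro hk
      rw [Finset.sum_range_succ, ih (by omega)]
      have h1 := vertexType_apply x (⟨k, by omega⟩, ⟨0, hn⟩)
      have h2 : restrict (vertexType x) Set.univ k 0 ≠ none ↔
          x (Sum.inl (⟨0, hn⟩, ⟨k, by omega⟩)) = x (Sum.inl (⟨0, hn⟩, ⟨k + 1, hk⟩)) := by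
        rw [restrict_ne_none_iff]
        simp only [Set.mem_univ, and_true]
        simp only at h1
        rw [h1]
        change (if x (Sum.inl (⟨0, hn⟩, ⟨k, by omega⟩)) = x (Sum.inl (⟨0, hn⟩, ⟨k + 1, hk⟩)) then _
          else none) ≠ none ↔ _
        split_ifs with h <;> simp [h]
      rw [ind_congr h2]
      push_cast
      generalize x (Sum.inl (⟨0, hn⟩, ⟨k + 1, hk⟩)) = q
      generalize x (Sum.inl (⟨0, hn⟩, ⟨k, _⟩)) = p
      generalize ind (x (cornerEdge hn) = true) = A
      generalize (k : ZMod 2) = B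
      revert p q A B
      decide
  exact key n (Nat.lt_succ_self n)

theorem agreeOff_reverse (x : Orientation n) (f : Cell n) :
    AgreeOff (f.1, f.2) (vertexType x) (vertexType (reverse x f)) := by
  intro i j h
  by_cases hij : i < n ∧ j < n
  · obtain ⟨p, q⟩ := f
    have e1 := vertexType_apply x (⟨i, hij.1⟩, ⟨j, hij.2⟩)
    have e2 := vertexType_apply (reverse x (p, q)) (⟨i, hij.1⟩, ⟨j, hij.2⟩)
    simp only at e1 e2 h
    have hl : ccw (p, q) (leftEdge (⟨i, hij.1⟩, ⟨j, hij.2⟩)) = none := by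
      simp [ccw, leftEdge, Fin.ext_iff]; grind
    have hr : ccw (p, q) (rightEdge (⟨i, hij.1⟩, ⟨j, hij.2⟩)) = none := by
      simp [ccw, rightEdge, Fin.ext_iff]; grind
    have hb : ccw (p, q) (bottomEdge (⟨i, hij.1⟩, ⟨j, hij.2⟩)) = none := by
      simp [ccw, bottomEdge, Fin.ext_iff]; grind
    rw [e1, e2]
    simp [reverse, hl, hr, hb]
  · rw [vertexType_eq_none hij, vertexType_eq_none hij]

/-- Far from the corner neither summand of `background` changes. Near the corner the parity of left
components changes as the parity of the whole lowest row does; by `rowParity_univ` that is the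
change of the corner edge, since the easternmost edge of the row is untouched. The two changes
cancel modulo two. -/
theorem background_reverse (hn : 0 < n) {x : Orientation n} (hx : IceRule x) {f : Cell n}
    (hf : IsCyclic x f) {L : ℕ} (hL : 2 * L < n) (hL1 : 1 ≤ L) (h1 : ¬ HasLongContour L x)
    (h2 : ¬ HasLongContour L (reverse x f)) :
    background hn (reverse x f) = background hn x := by
  have s1 : HasShortTrails L (vertexType x) := fun u w p hp => by
    by_contra h; exact h1 ⟨u, w, p, hp, not_lt.1 h⟩
  have s2 : HasShortTrails L (vertexType (reverse x f)) := fun u w p hp => by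
    by_contra h; exact h2 ⟨u, w, p, hp, not_lt.1 h⟩
  have ha := agreeOff_reverse x f
  unfold background
  by_cases hfar : L < (f.1 : ℕ) ∨ L < (f.2 : ℕ)
  · rw [ha.rowParity_leftCells_far s1 s2 hfar]
    have : ccw f (cornerEdge hn) = none := by
      obtain ⟨p, q⟩ := f
      simp only at hfar
      simp [ccw, cornerEdge, Fin.ext_iff]; grind
    simp [reverse, this]
  · push Not at hfar
    have h3 := ha.rowParity_leftCells_near s1 s2 (isEven_vertexType hx)
      (isEven_vertexType (iceRule_reverse hx hf)) hfar.1 hfar.2 hL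
    rw [rowParity_univ hn, rowParity_univ hn] at h3
    have h4 : reverse x f (Sum.inl (⟨0, hn⟩, Fin.last n)) = x (Sum.inl (⟨0, hn⟩, Fin.last n)) := by
      have : ccw f (Sum.inl (⟨0, hn⟩, Fin.last n)) = none := by
        obtain ⟨p, q⟩ := f
        simp only at hfar
        simp [ccw, Fin.ext_iff]; grind
      simp [reverse, this]
    rw [h4] at h3
    generalize ind (x (Sum.inl (⟨0, hn⟩, Fin.last n)) = true) = A at *
    generalize ind (x (cornerEdge hn) = true) = B at *
    generalize ind (reverse x f (cornerEdge hn) = true) = C at *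
    generalize rowParity n (vertexType x) _ = D at *
    generalize rowParity n (vertexType (reverse x f)) _ = E at *
    generalize (n : ZMod 2) = F at *
    grind

/-! ## Global reversal -/

theorem vertexType_not (x : Orientation n) : vertexType (fun e => !(x e)) = vertexType x := by
  funext i j
  by_cases hij : i < n ∧ j < n
  · have e1 := vertexType_apply x (⟨i, hij.1⟩, ⟨j, hij.2⟩)
    have e2 := vertexType_apply (fun e => !(x e)) (⟨i, hij.1⟩, ⟨j, hij.2⟩)
    simp only at e1 e2
    rw [e1, e2]
    simp
  · rw [vertexType_eq_none hij, vertexType_eq_none hij]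

theorem background_not (hn : 0 < n) (x : Orientation n) :
    background hn (fun e => !(x e)) = background hn x + 1 := by
  unfold background
  rw [vertexType_not]
  change ind ((!x (cornerEdge hn)) = true) + _ = _
  generalize x (cornerEdge hn) = p
  generalize rowParity n (vertexType x) _ = A
  revert p A
  decide

/-- Reversing all edges. -/
def negate : State n ≃ State n :=
  Function.Involutive.toPerm (fun x => ⟨fun e => !(x.1 e), by
    have := iceRule_iff.1 x.2
    exact iceRule_iff.2 fun v => by simpa using this v⟩)
    fun x => Subtype.ext (funext fun e => Bool.not_not _)

theorem weight_negate (a b c : ℝ) (x : State n) : weight a b c (negate x) = weight a b c x := by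
  unfold weight
  refine Finset.prod_congr rfl fun v _ => ?_
  have : vertexType (negate x).1 v.1 v.2 = vertexType x.1 v.1 v.2 :=
    congrFun₂ (vertexType_not x.1) _ _
  rw [vertexWeight_eq, vertexWeight_eq, this]

/-! ## The bottleneck -/

open Classical in
-- By symmetry each background has mass (1 - π(F))/2, which is at least 1/4 as `G` is at most 1/2;
-- `bottleneck` then gives 1/16 ≤ t G.
theorem exp_le_mixingTime {a b c : ℝ} (ha : 0 < a) (hb : 0 < b) (hc : 0 < c) {L : ℕ} (hL1 : 1 ≤ L)
    (hL : 2 * L < n) {G K : ℝ} (hG : 0 < G) (hG' : G ≤ 1 / 2) (hK : K * (16 * G) ≤ 1)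
    (hF : ∑ x : State n with HasLongContour L x.1, weight a b c x ≤
      G * partitionFunction n a b c) :
    ENNReal.ofReal K ≤ (mixingTime (glauber n a b c) (gibbs a b c) : ENNReal) := by
  have hn : 0 < n := by omega
  have hZ := partitionFunction_pos (n := n) ha hb hc
  set F : Finset (State n) := Finset.univ.filter fun x => HasLongContour L x.1 with hFdef
  set S : Finset (State n) := Finset.univ.filter fun x =>
    ¬ HasLongContour L x.1 ∧ background hn x.1 = 0 with hS
  set S' : Finset (State n) := Finset.univ.filter fun x =>
    ¬ HasLongContour L x.1 ∧ background hn x.1 ≠ 0 with hS'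
  have hπF : ∑ x ∈ F, gibbs a b c x ≤ G := by
    unfold gibbs
    rwa [← Finset.sum_div, div_le_iff₀ hZ]
  have hsum : ∑ x ∈ F, gibbs a b c x + (∑ x ∈ S, gibbs a b c x + ∑ x ∈ S', gibbs a b c x) = 1 := by
    rw [← sum_gibbs (n := n) ha hb hc, hS, hS', hFdef,
      ← Finset.sum_filter_add_sum_filter_not Finset.univ fun x : State n => HasLongContour L x.1]
    congr 1
    rw [← Finset.sum_filter_add_sum_filter_not
      (Finset.univ.filter fun x : State n => ¬ HasLongContour L x.1) fun x => background hn x.1 = 0,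
      Finset.filter_filter, Finset.filter_filter]
  have hsymm : ∑ x ∈ S, gibbs a b c x = ∑ x ∈ S', gibbs a b c x := by
    refine Finset.sum_equiv negate (fun x => ?_) fun x _ => ?_
    · simp only [hS, hS', Finset.mem_filter, Finset.mem_univ, true_and]
      have h1 : HasLongContour L (negate x).1 ↔ HasLongContour L x.1 := by
        unfold HasLongContour
        have : vertexType (negate x).1 = vertexType x.1 := vertexType_not x.1
        rw [this]
      have h2 : background hn (negate x).1 = background hn x.1 + 1 := background_not hn x.1
      rw [h1, h2]
      refine and_congr_right fun _ => ?_
      generalize background hn x.1 = A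
      revert A
      decide
    · unfold gibbs
      rw [weight_negate]
  have hF0 : 0 ≤ ∑ x ∈ F, gibbs a b c x :=
    Finset.sum_nonneg fun x _ => (gibbs_pos ha hb hc x).le
  refine le_mixingTime fun t ht => ?_
  have key := bottleneck (glauber_nonneg ha hb hc) glauber_row_sum
    (fun x => (gibbs_pos ha hb hc x).le) (sum_gibbs ha hb hc) (glauber_stationary ha hb hc)
    (S := S) (F := F) (fun x hx y hy hyF => ?_) (by linarith) ht
  · have h1 : (t : ℝ) * ∑ x ∈ F, gibbs a b c x ≤ t * G :=
      mul_le_mul_of_nonneg_left hπF (Nat.cast_nonneg t)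
    have h2 : 1 ≤ t * (16 * G) := by linarith
    exact le_of_mul_le_mul_right (hK.trans h2) (by positivity)
  · by_contra hne
    have hyx : y ≠ x := fun h => hy (h ▸ hx)
    obtain ⟨f, hf, rfl⟩ := exists_flip_of_glauber_ne_zero hne hyx
    have hx' := (Finset.mem_filter.1 hx).2
    have hy' : ¬ HasLongContour L (flip x f hf).1 := fun h =>
      hyF (Finset.mem_filter.2 ⟨Finset.mem_univ _, h⟩)
    refine hy (Finset.mem_filter.2 ⟨Finset.mem_univ _, hy', ?_⟩)
    exact (background_reverse hn x.2 hf hL hL1 hx'.1 hy').trans hx'.2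

/-! ### Exponential decay against polynomial factors -/

theorem eventually_poly_mul_pow_le {θ : ℝ} (hθ0 : 0 < θ) (hθ1 : θ < 1) (D : ℝ) :
    ∃ κ : ℝ, 0 < κ ∧ ∀ᶠ n : ℕ in Filter.atTop,
      Real.exp (κ * n) * (D * (n + 1) ^ 4 * θ ^ (n / 3)) ≤ 1 := by
  have hlog := Real.log_neg hθ0 hθ1
  -- With this choice θ^(n/3) is about exp(-2κn): half of the exponent pays for exp(κn), the other
  -- half for the polynomial. Rounding n/3 down costs at most the factor exp(6κ).
  set κ := -Real.log θ / 6 with hκ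
  have hκ0 : 0 < κ := by rw [hκ]; linarith
  refine ⟨κ, hκ0, ?_⟩
  have hr : |Real.exp (-κ)| < 1 := by
    rw [abs_of_pos (Real.exp_pos _), Real.exp_lt_one_iff]
    linarith
  have h1 := (tendsto_pow_const_mul_const_pow_of_abs_lt_one 4 hr).const_mul
    (|D| * 16 * Real.exp (6 * κ))
  rw [mul_zero] at h1
  filter_upwards [h1.eventually_le_const zero_lt_one, Filter.eventually_ge_atTop 1] with n h2 hn
  refine le_trans ?_ h2
  have hn' : (1 : ℝ) ≤ n := by exact_mod_cast hn
  have h3 : θ ^ (n / 3) ≤ Real.exp (6 * κ) * Real.exp (-(2 * κ * n)) := by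
    have hθ : θ = Real.exp (-(6 * κ)) := by
      rw [hκ, show -(6 * (-Real.log θ / 6)) = Real.log θ by ring, Real.exp_log hθ0]
    rw [hθ, ← Real.exp_nat_mul, ← Real.exp_add, Real.exp_le_exp]
    have h4 : (n : ℝ) ≤ 3 * ((n / 3 : ℕ) : ℝ) + 3 := by
      have : n ≤ 3 * (n / 3) + 3 := by omega
      exact_mod_cast this
    nlinarith
  have h5 : ((n : ℝ) + 1) ^ 4 ≤ 16 * n ^ 4 := by
    calc ((n : ℝ) + 1) ^ 4 ≤ (2 * n) ^ 4 := pow_le_pow_left₀ (by positivity) (by linarith) 4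
      _ = 16 * n ^ 4 := by ring
  have h6 : Real.exp (κ * n) * Real.exp (-(2 * κ * n)) = Real.exp (-κ) ^ n := by
    rw [← Real.exp_add, ← Real.exp_nat_mul]
    congr 1
    ring
  calc Real.exp (κ * n) * (D * (n + 1) ^ 4 * θ ^ (n / 3))
      ≤ Real.exp (κ * n) * (|D| * (16 * n ^ 4) *
          (Real.exp (6 * κ) * Real.exp (-(2 * κ * n)))) := by
        gcongr
        exact le_abs_self D
    _ = |D| * 16 * Real.exp (6 * κ) * (n ^ 4 *
          (Real.exp (κ * n) * Real.exp (-(2 * κ * n)))) := by ring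
    _ = _ := by rw [h6]

end SixVertex

end

/-! ### The main theorem -/

theorem theorem2 (a b c : ℝ) (ha : 0 < a) (hb : 0 < b) (hc : 0 < c)
    (h : a * c + b * c + 3 * a * b < c ^ 2) :
    ∃ κ : ℝ, 0 < κ ∧ ∀ᶠ n : ℕ in Filter.atTop,
      ENNReal.ofReal (Real.exp (κ * n)) ≤
        (SixVertex.mixingTime (SixVertex.glauber n a b c) (SixVertex.gibbs a b c) : ENNReal) := by
  have hα : 0 < a / c := div_pos ha hc
  have hβ : 0 < b / c := div_pos hb hc
  have hαβ : a / c + b / c + 3 * (a / c) * (b / c) < 1 := by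
    have : a / c + b / c + 3 * (a / c) * (b / c) = (a * c + b * c + 3 * a * b) / c ^ 2 := by
      field_simp
    rw [this, div_lt_one (by positivity)]
    exact h
  obtain ⟨θ, hθ0, hθ1, hθ⟩ := SixVertex.exists_sum_nonbacktracking_le hα hβ hαβ
  obtain ⟨κ, hκ, hev⟩ :=
    -- The constant 64 is the 16 of `exp_le_mixingTime` times the 4 of `sum_weight_longContour_le`.
    SixVertex.eventually_poly_mul_pow_le hθ0 hθ1 (64 * (1 + a / c + b / c))
  refine ⟨κ, hκ, ?_⟩
  filter_upwards [hev, Filter.eventually_ge_atTop 3] with n hn hn3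
  -- The length n/3 keeps 2L < n, so that contours near the corner miss the opposite sides.
  have hF := SixVertex.sum_weight_longContour_le (n := n) ha hb hc hθ0 hθ1 (by positivity) hθ
    (L := n / 3) (by omega)
  have hG : 0 < 4 * ((n : ℝ) + 1) ^ 4 * ((1 + a / c + b / c) * θ ^ (n / 3)) := by positivity
  have hK : Real.exp (κ * n) *
      (16 * (4 * ((n : ℝ) + 1) ^ 4 * ((1 + a / c + b / c) * θ ^ (n / 3)))) ≤ 1 := by
    refine le_trans (le_of_eq ?_) hn
    ring
  refine SixVertex.exp_le_mixingTime ha hb hc (by omega) (by omega) hG ?_ hK hF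
  have h1 : 1 ≤ Real.exp (κ * n) := Real.one_le_exp (by positivity)
  nlinarith
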